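/- Let $\mathcal X\subseteq\mathbb R^d$, $c\in\mathbb R^d$, and let $\xi$ take values in a measurable space $\mathcal Y$. For each $\xi\in\mathcal Y$ let $\mathcal X_\xi\subseteq\mathcal X$ be convex. For samples $s=(s_1,\dots,s_m)\in\mathcal Y^m$, $m\ge 1$, the scenario program is $$\min_{x\in\mathcal X} c^\top x\quad\text{s.t. } x\in\mathcal X_{s_i},\ i=1,\dots,m ,$$ and we assume that every such instance has a feasible region with nonempty interior and a unique optimal solution $\hat x_m(s)$. (The set $\{(x,\xi):x\in\mathcal X_\xi\}$, the maps $\hat x_m$, and $\mathbb P_0$ and $\delta_\epsilon$ as functions of the data are assumed measurable; if $m=0$ occurs below, $\hat x_0\in\mathbb R^d$ is arbitrary.) For a probability measure $\mathbb P$ on $\mathcal Y$ and $\epsilon>0$, a point $x$ is feasible for the chance-constrained program (CCP) if $x\in\mathcal X$ and $\mathbb P(x\in\mathcal X_\xi)\ge 1-\epsilon$; for a set $\mathcal U$ of probability measures it is feasible for the distributionally robust CCP if $x\in\mathcal X$ and $\inf_{\mathbb Q\in\mathcal U}\mathbb Q(x\in\mathcal X_\xi)\ge1-\epsilon$. Put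 $$M(\mathbb P_0,\mathcal U,\delta)=\sup\{\mathbb Q(A):\mathbb Q\in\mathcal U,\ A\subseteq\mathcal Y\text{ measurable},\ \mathbb P_0(A)\le\delta\},$$ $$N_{exact}(\delta,\beta,d)=\min\Big\{n\ge 0:\sum_{i=0}^{d-1}\binom ni\delta^i(1-\delta)^{n-i}\le\beta\Big\}.$$ Let the data $D=(\xi_1,\dots,\xi_n)$ be i.i.d. from an unknown $\mathbb P$, with joint law $\mathbb P_{data}$. Let the set $\mathcal U_{data}=\mathcal U_{data}(D)$ of probability measures, the generating distribution $\mathbb P_0=\mathbb P_0(D)$ and the level $\delta_\epsilon=\delta_\epsilon(D)>0$ possibly depend on the data, and let $\epsilon,\beta>0$. A property is said to hold with confidence at least $\gamma$ if it holds on some event of probability at least $\gamma$ (for a measurable property this means that its probability is at least $\gamma$). **Theorem.** Suppose that $M(\mathbb P_0,\mathcal U_{data},\delta_\epsilon)\le\epsilon$ for every value of the data. Let $\hat x^{MC}$ be the solution of the scenario program with $N_{exact}(\delta_\epsilon,\beta,d)$ Monte Carlo samples which, given the data, are drawn i.i.d. from $\mathbb P_0$. 1. $\hat x^{MC}$ is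 feasible for the distributionally robust CCP over $\mathcal U_{data}$ with confidence at least $1-\beta$, both conditionally on each value of the data (with respect to the Monte Carlo samples) and under the joint law of the data and the Monte Carlo samples. 2. If moreover $\alpha\in\mathbb R$ is such that, with confidence at least $1-\alpha$ under $\mathbb P_{data}$, $\mathbb P\in\mathcal U_{data}$, then, under the joint law of the data and the Monte Carlo samples, $\hat x^{MC}$ is feasible for the original CCP under $\mathbb P$ with confidence at least $1-\alpha-\beta$. -/

import Mathlib

open MeasureTheory ProbabilityTheory
open scoped ENNReal

namespace ScenarioDRO

/-- `Nexact ε β d` is the smallest `n` with `∑_{i=0}^{d-1} (n choose i) ε^i (1-ε)^(n-i) ≤ β`. -/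
noncomputable def Nexact (ε β : ℝ) (d : ℕ) : ℕ :=
  sInf {n : ℕ | ∑ i ∈ Finset.range d, (n.choose i : ℝ) * ε ^ i * (1 - ε) ^ (n - i) ≤ β}

section Programs

variable {E 𝒴 : Type*}

/-- The feasible region of the scenario program with samples `s 0, …, s (m-1)`. -/
def scenarioRegion (𝒳 : Set E) (X : 𝒴 → Set E) {m : ℕ} (s : Fin m → 𝒴) : Set E :=
  {x | x ∈ 𝒳 ∧ ∀ i, x ∈ X (s i)}

/-- `x` is an optimal solution of the scenario program: minimise `⟪c, x⟫` over the points of `𝒳`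
that lie in `X (s i)` for every sample `s i`. -/
def IsScenarioSolution [NormedAddCommGroup E] [InnerProductSpace ℝ E]
    (c : E) (𝒳 : Set E) (X : 𝒴 → Set E) {m : ℕ} (s : Fin m → 𝒴) (x : E) : Prop :=
  x ∈ scenarioRegion 𝒳 X s ∧ ∀ y ∈ scenarioRegion 𝒳 X s, inner ℝ c x ≤ inner ℝ c y

variable [MeasurableSpace 𝒴]

/-- Feasibility for the chance-constrained program under `P`: `x ∈ 𝒳` and
`P (x ∈ X_ξ) ≥ 1 - ε`. -/
def CCPFeasible (𝒳 : Set E) (X : 𝒴 → Set E) (ε : ℝ) (P : ProbabilityMeasure 𝒴) (x : E) : Prop :=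
  x ∈ 𝒳 ∧ ENNReal.ofReal (1 - ε) ≤ (P : Measure 𝒴) {ξ | x ∈ X ξ}

/-- Feasibility for the distributionally robust chance-constrained program over `U`: `x ∈ 𝒳` and
`inf_{Q ∈ U} Q (x ∈ X_ξ) ≥ 1 - ε`. -/
def DRCCPFeasible (𝒳 : Set E) (X : 𝒴 → Set E) (ε : ℝ) (U : Set (ProbabilityMeasure 𝒴)) (x : E) :
    Prop :=
  x ∈ 𝒳 ∧ ENNReal.ofReal (1 - ε) ≤ ⨅ Q ∈ U, (Q : Measure 𝒴) {ξ | x ∈ X ξ}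

/-- The optimal value `M(P₀, U, δ)` of: maximise `Q A` over `Q ∈ U` and events `A` with
`P₀ A ≤ δ`. -/
noncomputable def boundM (P₀ : Measure 𝒴) (U : Set (ProbabilityMeasure 𝒴)) (δ : ℝ) : ℝ≥0∞ :=
  ⨆ Q ∈ U, ⨆ A ∈ {A : Set 𝒴 | MeasurableSet A ∧ P₀ A ≤ ENNReal.ofReal δ}, (Q : Measure 𝒴) A

end Programs

/-- Under `μ`, the property `G` holds with confidence at least `γ`: some event of probability at
least `γ` is contained in `G`. For a measurable `G` this just says `γ ≤ μ G`. -/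
def HoldsWithConfidence {Ω : Type*} [MeasurableSpace Ω] (μ : Measure Ω) (γ : ℝ) (G : Ω → Prop) :
    Prop :=
  ∃ E : Set Ω, MeasurableSet E ∧ ENNReal.ofReal γ ≤ μ E ∧ ∀ ω ∈ E, G ω

theorem holdsWithConfidence_iff {Ω : Type*} [MeasurableSpace Ω] (μ : Measure Ω) (γ : ℝ)
    (G : Ω → Prop) (hG : MeasurableSet {ω | G ω}) :
    HoldsWithConfidence μ γ G ↔ ENNReal.ofReal γ ≤ μ {ω | G ω} :=
  ⟨fun ⟨_, _, h, hE⟩ => h.trans (measure_mono hE), fun h => ⟨_, hG, h, fun _ hω => hω⟩⟩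

/-- Given the data `D`, the law of a sequence of i.i.d. Monte Carlo samples drawn from `P₀ D`. -/
noncomputable def mcKernel {Δ 𝒴 : Type*} [MeasurableSpace Δ] [MeasurableSpace 𝒴]
    (P₀ : Kernel Δ 𝒴) [IsMarkovKernel P₀] : Kernel Δ (ℕ → 𝒴) where
  toFun D := Measure.infinitePi fun _ : ℕ => P₀ D
  measurable' := by
    refine Measurable.measure_of_isPiSystem_of_isProbabilityMeasure
      generateFrom_squareCylinders.symm
      (isPiSystem_squareCylinders (fun _ => MeasurableSpace.isPiSystem_measurableSet)
        (fun _ => MeasurableSet.univ)) ?_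
    rintro _ ⟨s, t, ht, rfl⟩
    have ht' : ∀ i, MeasurableSet (t i) := fun i => ht i (Set.mem_univ i)
    simp_rw [Measure.infinitePi_pi (fun _ : ℕ => P₀ _) (fun i _ => ht' i)]
    exact Finset.measurable_prod _ fun i _ => Kernel.measurable_coe P₀ (ht' i)

theorem mcKernel_apply {Δ 𝒴 : Type*} [MeasurableSpace Δ] [MeasurableSpace 𝒴]
    (P₀ : Kernel Δ 𝒴) [IsMarkovKernel P₀] (D : Δ) :
    mcKernel P₀ D = Measure.infinitePi fun _ : ℕ => P₀ D := rfl

instance {Δ 𝒴 : Type*} [MeasurableSpace Δ] [MeasurableSpace 𝒴]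
    (P₀ : Kernel Δ 𝒴) [IsMarkovKernel P₀] : IsMarkovKernel (mcKernel P₀) :=
  ⟨fun D => by rw [mcKernel_apply]; infer_instance⟩

/-- The joint law of the data, `n` i.i.d. draws from `P`, and of the Monte Carlo samples, which
given the data `D` are i.i.d. draws from `P₀ D`. -/
noncomputable def jointLaw {𝒴 : Type*} [MeasurableSpace 𝒴] (P : ProbabilityMeasure 𝒴) (n : ℕ)
    (P₀ : Kernel (Fin n → 𝒴) 𝒴) [IsMarkovKernel P₀] : Measure ((Fin n → 𝒴) × (ℕ → 𝒴)) :=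
  (Measure.pi fun _ : Fin n => (P : Measure 𝒴)) ⊗ₘ mcKernel P₀

end ScenarioDRO

/-!
A point whose violation probability under `P₀` is at most `δ` has violation probability at most
`M(P₀, U, δ) ≤ ε` under every member of `U`, so the theorem reduces to the Campi–Garatti bound
`measure_violation_gt_le`: the solution of a scenario program with `N` samples is violated with
probability more than `δ` only with probability at most `∑_{i<d} (N choose i) δ^i (1-δ)^(N-i)`.
Everything else is conditioning on the data and a union bound.

The Campi–Garatti bound is usually proved by assuming that every instance has exactly `d` support
constraints and by approximating the general case. Here the degenerate cases are dealt with in a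
finite problem. Among `N + k` samples, the subsamples `R` of size `N` are equally likely to be the
first `N`, so it suffices to count, for a fixed sample, the `R` whose solution violates at least `j`
of the constraints (`choose_mul_measure_violationEvent_le`). Letting `k` tend to infinity with
`j = ⌊δ k⌋`, the law of large numbers turns the number of violated constraints into the violation
probability, and the hypergeometric bound into the binomial one.

For the count, a finite problem is perturbed into a nondegenerate one without losing violated
constraints (`exists_isIntervalDecomposition_of_minimizers`). The constraint sets are replaced by
convex hulls of finitely many solutions, the objective is made strictly convex, and the constraint
sets are enlarged by amounts `t i`. The optimal value is a convex function of `t`, hence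
differentiable at almost every `t`; where it is differentiable, the sets of constraints that
determine it are closed under intersections (`ConvexProgram.value_inter_eq`). So each `R` has a
least support set, of size at most `d` by Helly's theorem, and the sets of constraints
are partitioned into intervals, from the support set up to the set of all satisfied constraints.

Finally, such a partition has a prescribed number of intervals of each kind once every interval is
split further into intervals with lower ends of size exactly `d`: the numbers of `r`-element sets,
for all `r`, form a triangular system of linear equations. This gives the bound
`IsIntervalDecomposition.card_le_sum_choose`.
-/

/-! ### Intervals of finite sets -/

/-- The `(D + ρ)`-element subsets of `D + L` elements, counted by the number `k` of elements that
they miss before their `D`-th element. -/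
theorem Nat.sum_multichoose_mul_choose (D L ρ : ℕ) :
    ∑ k ∈ Finset.range (L + 1), D.multichoose k * (L - k).choose ρ
      = (D + L).choose (D + ρ) := by
  induction D generalizing L with
  | zero =>
    rw [Finset.sum_range_succ', Finset.sum_eq_zero (fun k _ => by simp)]
    simp
  | succ D ihD =>
    induction L with
    | zero =>
      rcases Nat.eq_zero_or_pos ρ with h | h
      · simp [h]
      · rw [Nat.choose_eq_zero_of_lt (show D + 1 + 0 < D + 1 + ρ by omega)]
        simp [Nat.choose_eq_zero_of_lt h]
    | succ L ihL =>
      have h1 := ihD (L + 1)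
      rw [Finset.sum_range_succ'] at h1 ⊢
      simp only [Nat.multichoose_succ_succ, add_mul, Finset.sum_add_distrib, Nat.reduceSubDiff,
        Nat.multichoose_zero_right] at h1 ihL ⊢
      rw [ihL]
      have h2 : (D + 1 + (L + 1)).choose (D + 1 + ρ)
          = (D + (L + 1)).choose (D + ρ) + (D + 1 + L).choose (D + 1 + ρ) := by
        rw [show D + 1 + (L + 1) = (D + L + 1) + 1 by ring, show D + 1 + ρ = (D + ρ) + 1 by ring,
          Nat.choose_succ_succ]
        congr 2; ring
      omega

theorem Nat.sum_choose_mul_choose_succ (m M ρ e : ℕ) :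
    ∑ i ∈ Finset.range (e + 1), m.choose i * (M + 1).choose (e + 1 + ρ - i)
      = ∑ i ∈ Finset.range (e + 1), (m + 1).choose i * M.choose (e + 1 + ρ - i)
        + m.choose e * M.choose ρ := by
  induction e generalizing ρ with
  | zero =>
    simp [Nat.add_comm 1 ρ, Nat.choose_succ_succ, add_comm]
  | succ e ih =>
    rw [Finset.sum_range_succ, Finset.sum_range_succ (n := e + 1)]
    have h := ih (ρ + 1)
    rw [show e + 1 + (ρ + 1) = e + 1 + 1 + ρ by ring] at h
    rw [h, show e + 1 + 1 + ρ - (e + 1) = ρ + 1 by omega, Nat.choose_succ_succ M,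
      Nat.choose_succ_succ m]
    ring

/-- The arrangements of `e + 1 + ρ` successes among `L + e + 1` draws such that the `(e + 1)`-st
success comes after the first `e + j` draws, counted in two ways: by the number `k ≥ j` of
failures before that success, and by the number `i ≤ e` of successes among the first `e + j`
draws. -/
theorem Nat.sum_Ico_multichoose_mul_choose (e L ρ j : ℕ) (hj : j ≤ L + 1) :
    ∑ k ∈ Finset.Ico j (L + 1), (e + 1).multichoose k * (L - k).choose ρ
      = ∑ i ∈ Finset.range (e + 1), (e + j).choose i * (L + 1 - j).choose (e + 1 + ρ - i) := by
  induction hj using Nat.decreasingInduction with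
  | self =>
    rw [Finset.Ico_self, Finset.sum_empty, eq_comm]
    refine Finset.sum_eq_zero fun i hi => ?_
    rw [Finset.mem_range] at hi
    rw [Nat.sub_self, Nat.choose_eq_zero_of_lt (show 0 < e + 1 + ρ - i by omega), mul_zero]
  | of_succ j hj ih =>
    rw [Finset.sum_eq_sum_Ico_succ_bot hj, ih, show L + 1 - j = (L - j) + 1 by omega,
      Nat.sum_choose_mul_choose_succ, Nat.multichoose_eq, show L + 1 - (j + 1) = L - j by omega,
      show e + 1 + j - 1 = e + j by omega, Nat.choose_symm_add]
    exact add_comm _ _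

/-- The system of linear equations with coefficients `(L - k).choose ρ` is triangular. -/
theorem Nat.eq_of_sum_mul_choose_eq {L : ℕ} {a b : ℕ → ℕ}
    (h : ∀ ρ ≤ L, ∑ k ∈ Finset.range (L + 1), a k * (L - k).choose ρ
      = ∑ k ∈ Finset.range (L + 1), b k * (L - k).choose ρ) :
    ∀ k ≤ L, a k = b k := by
  intro k
  induction k using Nat.strong_induction_on with
  | _ k ih =>
    intro hk
    have key : ∀ f : ℕ → ℕ, ∑ l ∈ Finset.range (L + 1), f l * (L - l).choose (L - k)
        = ∑ l ∈ Finset.range k, f l * (L - l).choose (L - k) + f k := by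
      intro f
      rw [← Finset.sum_range_add_sum_Ico _ (show k + 1 ≤ L + 1 by omega), Finset.sum_range_succ,
        Nat.choose_self, mul_one, add_eq_left]
      refine Finset.sum_eq_zero fun l hl => ?_
      rw [Finset.mem_Ico] at hl
      rw [Nat.choose_eq_zero_of_lt (by omega), mul_zero]
    have h1 := h (L - k) (Nat.sub_le _ _)
    have h2 : ∑ l ∈ Finset.range k, a l * (L - l).choose (L - k)
        = ∑ l ∈ Finset.range k, b l * (L - l).choose (L - k) := by
      refine Finset.sum_congr rfl fun l hl => ?_
      rw [Finset.mem_range] at hl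
      rw [ih l hl (by omega)]
    rw [key a, key b] at h1
    omega

namespace ScenarioDRO

open Finset

/-- A decomposition of the subsets of a finite set into intervals `[S R, (V R)ᶜ]` whose lower ends
have at most `d` elements. Combinatorially this is a nondegenerate problem of dimension `d`:
`S R` is the set of support constraints of `R`, and `V R` the set of constraints that the
solution for `R` violates. -/
structure IsIntervalDecomposition {ι : Type*} (d : ℕ) (S V : Finset ι → Finset ι) : Prop where
  card_le : ∀ R, (S R).card ≤ d
  subset : ∀ R, S R ⊆ R
  disjoint : ∀ R, Disjoint (V R) R
  support_eq : ∀ R R', S R ⊆ R' → Disjoint (V R) R' → S R' = S R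
  violated_eq : ∀ R R', S R ⊆ R' → Disjoint (V R) R' → V R' = V R

namespace IsIntervalDecomposition

variable {ι : Type*} [Fintype ι] [DecidableEq ι] {d : ℕ} {S V : Finset ι → Finset ι}

theorem card_add_card_le (h : IsIntervalDecomposition d S V) (A : Finset ι) :
    #(S A) + #(V A) ≤ Fintype.card ι := by
  rw [← card_union_of_disjoint ((h.disjoint A).mono_right (h.subset A)).symm]
  exact card_le_univ _

/-- The members of size `r` of the interval with lower end `S A`. -/
theorem card_fiber (h : IsIntervalDecomposition d S V) {r : ℕ} (hr : d ≤ r) (A : Finset ι) :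
    #{R : Finset ι | #R = r ∧ (S R, V R) = (S A, V A)}
      = (Fintype.card ι - #(S A) - #(V A)).choose (r - #(S A)) := by
  have hdisj : Disjoint (V A) (S A) := (h.disjoint A).mono_right (h.subset A)
  have hcard : #((S A ∪ V A)ᶜ) = Fintype.card ι - #(S A) - #(V A) := by
    rw [card_compl, card_union_of_disjoint hdisj.symm, Nat.sub_sub]
  rw [← hcard, ← card_powersetCard]
  have hs := h.card_le A
  refine card_nbij' (fun R => R \ S A) (fun Q => Q ∪ S A) ?_ ?_ ?_ ?_
  · intro R hR
    simp only [coe_filter, mem_univ, true_and, Set.mem_ofPred_eq, Prod.mk.injEq] at hR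
    obtain ⟨hR, hS, hV⟩ := hR
    have h1 := h.subset R
    have h2 := h.disjoint R
    rw [hS] at h1
    rw [hV] at h2
    rw [mem_coe, mem_powersetCard]
    refine ⟨fun x hx => ?_, by rw [card_sdiff_of_subset h1, hR]⟩
    rw [mem_sdiff] at hx
    simp only [mem_compl, mem_union, not_or]
    exact ⟨hx.2, fun hxV => disjoint_left.1 h2 hxV hx.1⟩
  · intro Q hQ
    rw [mem_coe, mem_powersetCard] at hQ
    have hQ1 : ∀ x ∈ Q, x ∉ S A ∧ x ∉ V A := fun x hx => by simpa using hQ.1 hx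
    have hd : Disjoint Q (S A) := disjoint_left.2 fun x hx => (hQ1 x hx).1
    have hV : Disjoint (V A) (Q ∪ S A) := by
      rw [disjoint_union_right]
      exact ⟨disjoint_right.2 fun x hx => (hQ1 x hx).2, hdisj⟩
    simp only [coe_filter, mem_univ, true_and, Set.mem_ofPred_eq, Prod.mk.injEq]
    refine ⟨?_, h.support_eq A _ subset_union_right hV, h.violated_eq A _ subset_union_right hV⟩
    rw [card_union_of_disjoint hd, hQ.2]
    omega
  · intro R hR
    simp only [coe_filter, mem_univ, true_and, Set.mem_ofPred_eq, Prod.mk.injEq] at hR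
    have h1 := h.subset R
    rw [hR.2.1] at h1
    exact sdiff_union_of_subset h1
  · intro Q hQ
    rw [mem_coe, mem_powersetCard] at hQ
    have hd : Disjoint Q (S A) := disjoint_left.2 fun x hx => by
      have := hQ.1 hx
      simp only [mem_compl, mem_union, not_or] at this
      exact this.1
    exact union_sdiff_cancel_right hd

/-- An interval with lower end of size `s` splits into intervals with lower ends of size `d`: its
`r`-element members are counted by the number of elements that the larger lower end excludes. -/
theorem choose_eq_sum {n d s v r : ℕ} (hs : s ≤ d) (hr : d ≤ r) (hn : d ≤ n)
    (hsv : s + v ≤ n) :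
    (n - s - v).choose (r - s) = ∑ k ∈ Ico v (n - d + 1),
      (d - s).multichoose (k - v) * (n - d - k).choose (r - d) := by
  by_cases hv : v ≤ n - d
  · rw [sum_Ico_eq_sum_range, show n - d + 1 - v = (n - d - v) + 1 by omega]
    have h := Nat.sum_multichoose_mul_choose (d - s) (n - d - v) (r - d)
    rw [show d - s + (n - d - v) = n - s - v by omega, show d - s + (r - d) = r - s by omega] at h
    rw [← h]
    refine sum_congr rfl fun k _ => ?_
    rw [Nat.add_sub_cancel_left, Nat.sub_sub (n - d)]
  · rw [Ico_eq_empty (by omega), sum_empty, Nat.choose_eq_zero_of_lt (by omega)]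

/-- Among the `r`-element sets, those with at least `j` violated constraints are at most as many
as the `r`-element sets with fewer than `d` elements among `d + j - 1` given ones. -/
theorem card_le_sum_choose {e : ℕ} (h : IsIntervalDecomposition (e + 1) S V) {r j : ℕ}
    (hr : e + 1 ≤ r) (hj : e + j ≤ Fintype.card ι) (hn : e + 1 ≤ Fintype.card ι) :
    #{R : Finset ι | #R = r ∧ j ≤ #(V R)}
      ≤ ∑ i ∈ range (e + 1), (e + j).choose i * (Fintype.card ι - (e + j)).choose (r - i) := by
  set n := Fintype.card ι with hn_def
  set L := n - (e + 1) with hL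
  let T : Finset (Finset ι × Finset ι) := univ.image fun R => (S R, V R)
  have hT : ∀ {r}, e + 1 ≤ r → ∀ c ∈ T, #{R : Finset ι | #R = r ∧ (S R, V R) = c}
      = ∑ k ∈ Ico #c.2 (L + 1),
        (e + 1 - #c.1).multichoose (k - #c.2) * (L - k).choose (r - (e + 1)) := by
    intro r hr c hc
    obtain ⟨A, -, rfl⟩ := mem_image.1 hc
    rw [h.card_fiber hr A, choose_eq_sum (h.card_le A) hr hn (h.card_add_card_le A)]
  -- `N k` is the number of intervals excluding `k` elements after splitting all the intervals
  -- into intervals with lower ends of size `e + 1`.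
  let N : ℕ → ℕ := fun k => ∑ c ∈ T, if #c.2 ≤ k then (e + 1 - #c.1).multichoose (k - #c.2) else 0
  have hIco : ∀ (a : ℕ) (f : ℕ → ℕ), ∑ k ∈ Ico a (L + 1), f k
      = ∑ k ∈ range (L + 1), if a ≤ k then f k else 0 := by
    intro a f
    rw [← sum_filter]
    congr 1
    ext k
    simp only [mem_Ico, mem_filter, mem_range]
    tauto
  have hN : ∀ k ≤ L, N k = (e + 1).multichoose k := by
    refine Nat.eq_of_sum_mul_choose_eq fun ρ hρ => ?_
    rw [Nat.sum_multichoose_mul_choose, show e + 1 + L = n by omega]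
    have h1 : (univ.filter fun R : Finset ι => #R = e + 1 + ρ) = univ.powersetCard (e + 1 + ρ) := by
      ext R; simp [mem_powersetCard]
    have h2 := card_powersetCard (e + 1 + ρ) (univ : Finset ι)
    rw [card_univ, ← hn_def, ← h1, card_eq_sum_card_fiberwise (f := fun R => (S R, V R)) (t := T)
      (fun R _ => mem_coe.2 (mem_image_of_mem _ (mem_univ R)))] at h2
    rw [← h2]
    simp only [N, sum_mul]
    rw [sum_comm]
    refine sum_congr rfl fun c hc => ?_
    rw [filter_filter, hT (by omega) c hc, hIco, Nat.add_sub_cancel_left]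
    exact sum_congr rfl fun k _ => by split_ifs <;> simp
  have hmain : #{R : Finset ι | #R = r ∧ j ≤ #(V R)}
      ≤ ∑ k ∈ Ico j (L + 1), N k * (L - k).choose (r - (e + 1)) := by
    rw [card_eq_sum_card_fiberwise (f := fun R => (S R, V R)) (t := T)
      (fun R _ => mem_coe.2 (mem_image_of_mem _ (mem_univ R)))]
    simp only [N, sum_mul]
    rw [sum_comm]
    refine sum_le_sum fun c hc => ?_
    rw [filter_filter]
    by_cases hcj : j ≤ #c.2
    · calc _ ≤ #{R : Finset ι | #R = r ∧ (S R, V R) = c} :=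
            card_le_card fun R => by simp only [mem_filter]; tauto
        _ = _ := hT hr c hc
        _ ≤ _ := by
            rw [hIco, hIco]
            refine sum_le_sum fun k _ => ?_
            split_ifs <;> omega
    · rw [card_eq_zero.2]
      · exact Nat.zero_le _
      · ext R
        simp only [mem_filter, mem_univ, true_and, notMem_empty, iff_false]
        rintro ⟨⟨-, h1⟩, h2⟩
        rw [← h2] at hcj
        exact hcj h1
  refine hmain.trans (le_of_eq ?_)
  rw [sum_congr rfl fun k hk => by
    rw [hN k (by rw [mem_Ico] at hk; omega)], Nat.sum_Ico_multichoose_mul_choose _ _ _ _ (by omega)]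
  refine sum_congr rfl fun i _ => ?_
  congr 2 <;> omega

end IsIntervalDecomposition

end ScenarioDRO

/-! ### Convex programs with perturbed right-hand sides -/

namespace ScenarioDRO

open Finset Topology

/-- A strictly convex program on a compact domain with convex constraints `constraint i x ≤ t i`
for `i` in a subset of `ι`. The right-hand sides `t` are parameters; there is a point that
satisfies all the constraints with right-hand side `0`. -/
structure ConvexProgram (ι E : Type*) [NormedAddCommGroup E] [NormedSpace ℝ E] where
  domain : Set E
  constraint : ι → E → ℝ
  objective : E → ℝ
  isCompact_domain : IsCompact domain
  convexOn_constraint : ∀ i, ConvexOn ℝ domain (constraint i)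
  continuousOn_constraint : ∀ i, ContinuousOn (constraint i) domain
  strictConvexOn_objective : StrictConvexOn ℝ domain objective
  continuousOn_objective : ContinuousOn objective domain
  center : E
  center_mem : center ∈ domain
  constraint_center : ∀ i, constraint i center ≤ 0

namespace ConvexProgram

variable {ι E : Type*} [NormedAddCommGroup E] [NormedSpace ℝ E] (p : ConvexProgram ι E)

/-- The points of the domain that satisfy the constraints in `R` with right-hand sides `t`. -/
def feasible (R : Finset ι) (t : ι → ℝ) : Set E :=
  {x | x ∈ p.domain ∧ ∀ i ∈ R, p.constraint i x ≤ t i}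

variable {p} {R I J : Finset ι} {t t' : ι → ℝ}

theorem exists_minimizer (ht : 0 ≤ t) :
    ∃ x ∈ p.feasible R t, ∀ y ∈ p.feasible R t, p.objective x ≤ p.objective y := by
  have hclosed : ∀ i, IsClosed (p.domain ∩ {x | p.constraint i x ≤ t i}) := fun i =>
    (p.continuousOn_constraint i).preimage_isClosed_of_isClosed p.isCompact_domain.isClosed
      isClosed_Iic
  have heq : p.feasible R t = p.domain ∩ ⋂ i ∈ R, (p.domain ∩ {x | p.constraint i x ≤ t i}) := by
    ext x
    simp only [feasible, Set.mem_ofPred_eq, Set.mem_inter_iff, Set.mem_iInter]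
    exact ⟨fun h => ⟨h.1, fun i hi => ⟨h.1, h.2 i hi⟩⟩, fun h => ⟨h.1, fun i hi => (h.2 i hi).2⟩⟩
  have hcomp : IsCompact (p.feasible R t) := by
    rw [heq]
    exact p.isCompact_domain.inter_right (isClosed_biInter fun i _ => hclosed i)
  obtain ⟨x, hx, hmin⟩ := hcomp.exists_isMinOn
    ⟨p.center, p.center_mem, fun i _ => (p.constraint_center i).trans (ht i)⟩
    (p.continuousOn_objective.mono fun x hx => hx.1)
  exact ⟨x, hx, fun y hy => hmin hy⟩

variable (p R t) in
open Classical in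
/-- The minimizer of the objective over `p.feasible R t`; a junk value unless there is one, as
there is for `0 ≤ t`. -/
noncomputable def solution : E :=
  if h : ∃ x ∈ p.feasible R t, ∀ y ∈ p.feasible R t, p.objective x ≤ p.objective y then h.choose
  else p.center

variable (p R t) in
/-- The optimal value, as a function of the right-hand sides `t`. -/
noncomputable def value : ℝ := p.objective (p.solution R t)

theorem solution_mem (ht : 0 ≤ t) : p.solution R t ∈ p.feasible R t := by
  rw [solution, dif_pos (exists_minimizer ht)]
  exact (exists_minimizer ht).choose_spec.1

theorem value_le (ht : 0 ≤ t) {x : E} (hx : x ∈ p.feasible R t) :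
    p.value R t ≤ p.objective x := by
  rw [value, solution, dif_pos (exists_minimizer ht)]
  exact (exists_minimizer ht).choose_spec.2 x hx

theorem convex_feasible : Convex ℝ (p.feasible R t) := by
  intro x hx y hy a b ha hb hab
  refine ⟨p.strictConvexOn_objective.1 hx.1 hy.1 ha hb hab, fun i hi => ?_⟩
  calc _ ≤ a • p.constraint i x + b • p.constraint i y :=
        (p.convexOn_constraint i).2 hx.1 hy.1 ha hb hab
    _ ≤ a * t i + b * t i := by
        simp only [smul_eq_mul]
        gcongr
        exacts [hx.2 i hi, hy.2 i hi]
    _ = t i := by rw [← add_mul, hab, one_mul]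

theorem eq_solution (ht : 0 ≤ t) {x : E} (hx : x ∈ p.feasible R t)
    (h : p.objective x ≤ p.value R t) : x = p.solution R t := by
  refine (p.strictConvexOn_objective.subset (fun x hx => hx.1) convex_feasible).eq_of_isMinOn
    (s := p.feasible R t) (fun y hy => ?_) (fun y hy => ?_) hx (solution_mem ht)
  · exact h.trans (value_le ht hy)
  · exact value_le ht hy

theorem value_le_of_forall (ht : 0 ≤ t) (ht' : 0 ≤ t')
    (h : ∀ x ∈ p.domain, (∀ i ∈ R, p.constraint i x ≤ t i) → ∀ i ∈ I, p.constraint i x ≤ t' i) :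
    p.value I t' ≤ p.value R t :=
  value_le ht' ⟨(solution_mem ht).1, h _ (solution_mem ht).1 (solution_mem ht).2⟩

theorem value_mono_set (ht : 0 ≤ t) (h : I ⊆ R) : p.value I t ≤ p.value R t :=
  value_le_of_forall ht ht fun _ _ hx i hi => hx i (h hi)

theorem value_congr (ht : 0 ≤ t) (ht' : 0 ≤ t') (h : ∀ i ∈ R, t i = t' i) :
    p.value R t = p.value R t' :=
  le_antisymm
    (value_le_of_forall ht' ht fun _ _ hx i hi => (h i hi) ▸ hx i hi)
    (value_le_of_forall ht ht' fun _ _ hx i hi => (h i hi) ▸ hx i hi)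

variable (p R) in
theorem convexOn_value : ConvexOn ℝ {t : ι → ℝ | 0 ≤ t} (p.value R) := by
  refine ⟨convex_Ici 0, ?_⟩
  intro t ht t' ht' a b ha hb hab
  have hx := solution_mem (p := p) (R := R) ht
  have hy := solution_mem (p := p) (R := R) ht'
  have hmem : a • p.solution R t + b • p.solution R t' ∈ p.feasible R (a • t + b • t') := by
    refine ⟨p.strictConvexOn_objective.1 hx.1 hy.1 ha hb hab, fun i hi => ?_⟩
    refine ((p.convexOn_constraint i).2 hx.1 hy.1 ha hb hab).trans ?_
    simp only [smul_eq_mul, Pi.add_apply, Pi.smul_apply]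
    gcongr
    exacts [hx.2 i hi, hy.2 i hi]
  exact (value_le (convex_Ici (0 : ι → ℝ) ht ht' ha hb hab) hmem).trans
    (p.strictConvexOn_objective.convexOn.2 hx.1 hy.1 ha hb hab)

/-- By Helly's theorem the optimal value is already determined by as many constraints as the space
has dimensions. -/
theorem exists_subset_value_eq [DecidableEq ι] [FiniteDimensional ℝ E] (ht : 0 ≤ t) :
    ∃ I ⊆ R, #I ≤ Module.finrank ℝ E ∧ p.value I t = p.value R t := by
  by_contra! hcon
  -- the feasible sets of the single constraints, and the set of points with a smaller objective
  let F : Option ι → Set E := fun o => o.elim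
    {x ∈ p.domain | p.objective x < p.value R t} fun i => p.feasible {i} t
  have hF : (⋂ o ∈ insertNone R, F o).Nonempty := by
    refine Convex.helly_theorem' (𝕜 := ℝ) ?_ ?_
    · rintro (_ | i) -
      · exact p.strictConvexOn_objective.convexOn.convex_lt _
      · exact convex_feasible
    · intro K hK hcard
      by_cases hnone : none ∈ K
      · have hle : #(eraseNone K) ≤ Module.finrank ℝ E := by
          have h1 : #(K.erase none) + 1 = #K := card_erase_add_one hnone
          have h2 : #(eraseNone K) = #(K.erase none) := by
            rw [← card_map Function.Embedding.some, map_some_eraseNone]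
          omega
        have hsub : eraseNone K ⊆ R := fun i hi => by
          have := hK (mem_eraseNone.1 hi)
          simpa using this
        have hlt : p.value (eraseNone K) t < p.value R t :=
          lt_of_le_of_ne (value_mono_set ht hsub) (hcon _ hsub hle)
        have hx := solution_mem (p := p) (R := eraseNone K) ht
        refine ⟨p.solution (eraseNone K) t, Set.mem_iInter₂.2 ?_⟩
        rintro (_ | i) hi
        · exact ⟨hx.1, hlt⟩
        · exact ⟨hx.1, by simpa using hx.2 i (mem_eraseNone.2 hi)⟩
      · have hx := solution_mem (p := p) (R := R) ht
        refine ⟨p.solution R t, Set.mem_iInter₂.2 ?_⟩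
        rintro (_ | i) hi
        · exact absurd hi hnone
        · exact ⟨hx.1, by simpa using hx.2 i (by simpa using hK hi)⟩
  obtain ⟨x, hx⟩ := hF
  rw [Set.mem_iInter₂] at hx
  have h1 : x ∈ p.domain ∧ p.objective x < p.value R t := hx none (by simp)
  refine absurd h1.2 (not_lt.2 (value_le ht ⟨h1.1, fun i hi => ?_⟩))
  have h2 : x ∈ p.feasible {i} t := hx (some i) (by simpa using hi)
  exact h2.2 i (by simp)

/-- Where the optimal value for `R` is a differentiable function of the right-hand sides, its
partial derivatives vanish at the constraints that are not needed for this value: relaxing or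
tightening them slightly cannot give a smaller value. -/
theorem fderiv_value_single [Fintype ι] [DecidableEq ι] (ht : ∀ i, 0 < t i)
    (hd : DifferentiableAt ℝ (p.value R) t) (hI : I ⊆ R) (hv : p.value I t = p.value R t)
    {i : ι} (hi : i ∉ I) : fderiv ℝ (p.value R) t (Pi.single i 1) = 0 := by
  have hline : HasDerivAt (fun s : ℝ => p.value R (t + s • Pi.single i 1))
      (fderiv ℝ (p.value R) t (Pi.single i 1)) 0 := hd.hasFDerivAt.hasLineDerivAt _
  refine IsLocalMin.hasDerivAt_eq_zero ?_ hline
  have hev : ∀ᶠ s : ℝ in 𝓝 0, 0 < t i + s := by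
    have : Filter.Tendsto (fun s : ℝ => t i + s) (𝓝 0) (𝓝 (t i + 0)) :=
      (continuous_const.add continuous_id).tendsto 0
    rw [add_zero] at this
    exact this.eventually_const_lt (ht i)
  filter_upwards [hev] with s hs
  have hs' : 0 ≤ t + s • Pi.single i (1 : ℝ) := by
    intro k
    rcases eq_or_ne k i with rfl | hk
    · simpa using hs.le
    · simpa [hk] using (ht k).le
  simp only [zero_smul, add_zero]
  rw [← hv, value_congr (R := I) (fun k => (ht k).le) hs']
  · exact value_mono_set hs' hI
  · intro k hk
    have : k ≠ i := fun h => hi (h ▸ hk)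
    simp [this]

/-- Where the optimal value for `R` is a differentiable function of the right-hand sides, the
sets of constraints that determine it are closed under intersections. -/
theorem value_inter_eq [Fintype ι] [DecidableEq ι] (ht : ∀ i, 0 < t i)
    (hd : DifferentiableAt ℝ (p.value R) t) (hI : I ⊆ R) (hvI : p.value I t = p.value R t)
    (hJ : J ⊆ R) (hvJ : p.value J t = p.value R t) : p.value (I ∩ J) t = p.value R t := by
  have ht0 : 0 ≤ t := fun i => (ht i).le
  refine le_antisymm (value_mono_set ht0 (inter_subset_left.trans hI)) ?_
  -- a bound for all the constraints on the domain; beyond it a constraint is vacuous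
  obtain ⟨M, hM⟩ : ∃ M : ℝ, ∀ i, ∀ x ∈ p.domain, p.constraint i x ≤ M := by
    choose M hM using fun i => p.isCompact_domain.bddAbove_image (p.continuousOn_constraint i)
    obtain ⟨M', hM'⟩ := (Set.finite_range M).bddAbove
    exact ⟨M', fun i x hx => (hM i ⟨x, hx, rfl⟩).trans (hM' ⟨i, rfl⟩)⟩
  let u : ι → ℝ := ∑ i ∈ (I ∩ J)ᶜ, Pi.single i 1
  have hu : ∀ i, u i = if i ∈ I ∩ J then 0 else 1 := by
    intro i
    simp only [u, Finset.sum_apply, Pi.single_apply, sum_ite_eq, mem_compl, ite_not]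
  have hu0 : 0 ≤ u := fun i => by rw [hu]; split_ifs <;> simp
  have hDu : fderiv ℝ (p.value R) t u = 0 := by
    rw [map_sum]
    refine sum_eq_zero fun i hi => ?_
    rw [mem_compl, mem_inter, not_and_or] at hi
    rcases hi with hi | hi
    · exact fderiv_value_single ht hd hI hvI hi
    · exact fderiv_value_single ht hd hJ hvJ hi
  have hline : HasDerivAt (fun s : ℝ => p.value R (t + s • u)) 0 0 := by
    have := hd.hasFDerivAt.hasLineDerivAt u
    rwa [hDu] at this
  have hconv : ConvexOn ℝ (Set.Ici 0) (fun s : ℝ => p.value R (t + s • u)) := by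
    have h1 := (p.convexOn_value R).comp_affineMap (AffineMap.lineMap t (t + u))
    have h2 : (p.value R ∘ AffineMap.lineMap t (t + u)) = fun s : ℝ => p.value R (t + s • u) := by
      funext s
      simp [AffineMap.lineMap_apply, add_comm]
    rw [h2] at h1
    refine h1.subset (fun s hs => ?_) (convex_Ici 0)
    simp only [Set.mem_preimage, AffineMap.lineMap_apply, vsub_eq_sub, add_sub_cancel_left,
      vadd_eq_add, Set.mem_ofPred_eq]
    exact add_nonneg (smul_nonneg hs hu0) ht0
  have hs0 : 0 < |M| + 1 := by positivity
  have hslope := hconv.le_slope_of_hasDerivAt (x := 0) (y := |M| + 1) (by simp) hs0.le hs0 hline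
  rw [slope_def_field, zero_smul, add_zero, sub_zero, le_div_iff₀ hs0, zero_mul, sub_nonneg]
    at hslope
  refine hslope.trans (value_le_of_forall ht0
    (add_nonneg ht0 (smul_nonneg hs0.le hu0)) fun x hx hxIJ i _ => ?_)
  simp only [Pi.add_apply, Pi.smul_apply, smul_eq_mul, hu]
  split_ifs with hi
  · simpa using hxIJ i hi
  · have := hM i x hx
    have := le_abs_self M
    have := ht i
    linarith

/-- At right-hand sides where all the optimal values are differentiable, the minimal support
sets are unique, and the program decomposes the sets of constraints into intervals. -/
theorem exists_isIntervalDecomposition [Fintype ι] [DecidableEq ι] [FiniteDimensional ℝ E]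
    (p : ConvexProgram ι E) (ht : ∀ i, 0 < t i) (hd : ∀ R, DifferentiableAt ℝ (p.value R) t) :
    ∃ S V, IsIntervalDecomposition (Module.finrank ℝ E) S V ∧
      ∀ R i, p.value R t < p.value (insert i R) t → i ∈ V R := by
  have ht0 : 0 ≤ t := fun i => (ht i).le
  have hS : ∀ R : Finset ι, ∃ S ⊆ R, p.value S t = p.value R t ∧
      ∀ I ⊆ R, p.value I t = p.value R t → S ⊆ I := by
    intro R
    obtain ⟨S, hS, hmin⟩ := exists_min_image (R.powerset.filter fun I => p.value I t = p.value R t)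
      card ⟨R, by simp⟩
    simp only [mem_filter, mem_powerset] at hS hmin
    refine ⟨S, hS.1, hS.2, fun I hI hv => ?_⟩
    have := hmin (S ∩ I) ⟨inter_subset_left.trans hS.1,
      value_inter_eq ht (hd R) hS.1 hS.2 hI hv⟩
    rw [← inter_eq_left]
    exact eq_of_subset_of_card_le inter_subset_left this
  choose S hSR hSv hSmin using hS
  have hsol : ∀ R R', S R ⊆ R' → (∀ i ∈ R', p.constraint i (p.solution R t) ≤ t i) →
      p.value R' t = p.value R t ∧ p.solution R' t = p.solution R t := by
    intro R R' h1 h2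
    have h3 : p.value R' t = p.value R t :=
      le_antisymm (value_le ht0 ⟨(solution_mem ht0).1, h2⟩)
        ((hSv R).symm.le.trans (value_mono_set ht0 h1))
    exact ⟨h3, (eq_solution ht0 ⟨(solution_mem ht0).1, h2⟩ h3.ge).symm⟩
  have hdisj : ∀ R R', Disjoint (univ.filter fun i => t i < p.constraint i (p.solution R t)) R' →
      ∀ i ∈ R', p.constraint i (p.solution R t) ≤ t i := by
    intro R R' h i hi
    simpa using disjoint_right.1 h hi
  refine ⟨S, fun R => univ.filter fun i => t i < p.constraint i (p.solution R t),
    ⟨fun R => ?_, hSR, fun R => ?_, fun R R' h1 h2 => ?_, fun R R' h1 h2 => ?_⟩, fun R i h => ?_⟩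
  · obtain ⟨I, hI, hcard, hv⟩ := exists_subset_value_eq (p := p) (R := R) ht0
    exact (card_le_card (hSmin R I hI hv)).trans hcard
  · refine disjoint_left.2 fun i hi hiR => ?_
    exact absurd ((solution_mem ht0).2 i hiR) (not_le.2 (by simpa using hi))
  · have h3 := (hsol R R' h1 (hdisj R R' h2)).1
    have h4 : S R' ⊆ S R := hSmin R' (S R) h1 ((hSv R).trans h3.symm)
    exact h4.antisymm (hSmin R (S R') (h4.trans (hSR R)) ((hSv R').trans h3))
  · rw [(hsol R R' h1 (hdisj R R' h2)).2]
  · rw [mem_filter]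
    refine ⟨mem_univ _, ?_⟩
    by_contra! hle
    refine absurd h (not_lt.2 (value_le ht0 ⟨(solution_mem ht0).1, fun k hk => ?_⟩))
    rcases mem_insert.1 hk with rfl | hk
    · exact hle
    · exact (solution_mem ht0).2 k hk

/-- The optimal values are convex functions of the right-hand sides, hence locally Lipschitz, and
Rademacher's theorem applies. -/
theorem exists_differentiableAt_value [Fintype ι] [DecidableEq ι] (p : ConvexProgram ι E) {ε : ℝ}
    (hε : 0 < ε) : ∃ t : ι → ℝ, (∀ i, 0 < t i) ∧ (∀ i, t i < ε) ∧
      ∀ R, DifferentiableAt ℝ (p.value R) t := by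
  let O : Set (ι → ℝ) := {t | ∀ i, 0 < t i ∧ t i < ε}
  have hO : IsOpen O := by
    have : O = Set.univ.pi fun _ => Set.Ioo 0 ε := by
      ext t; simp [O]
    rw [this]
    exact isOpen_set_pi Set.finite_univ fun _ _ => isOpen_Ioo
  have hconv : Convex ℝ O := by
    have : O = Set.univ.pi fun _ => Set.Ioo 0 ε := by
      ext t; simp [O]
    rw [this]
    exact convex_pi fun _ _ => convex_Ioo _ _
  let t₀ : ι → ℝ := fun _ => ε / 2
  have ht₀ : t₀ ∈ O := fun i => ⟨half_pos hε, half_lt_self hε⟩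
  have hlip : ∀ R : Finset ι, ∃ s ∈ 𝓝 t₀, ∃ C, LipschitzOnWith C (p.value R) s := by
    intro R
    have h1 : ConvexOn ℝ O (p.value R) :=
      (p.convexOn_value R).subset (fun t ht i => (ht i).1.le) hconv
    obtain ⟨C, s, hs, hC⟩ := h1.locallyLipschitzOn hO ht₀
    rw [hO.nhdsWithin_eq ht₀] at hs
    exact ⟨s, hs, C, hC⟩
  choose s hs C hC using hlip
  let A : Set (ι → ℝ) := O ∩ ⋂ R, interior (s R)
  have hA : IsOpen A := hO.inter (isOpen_iInter_of_finite fun R => isOpen_interior)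
  have hA0 : t₀ ∈ A := ⟨ht₀, Set.mem_iInter.2 fun R => mem_interior_iff_mem_nhds.2 (hs R)⟩
  have hae : ∀ᵐ t : ι → ℝ, ∀ R, t ∈ s R → DifferentiableWithinAt ℝ (p.value R) (s R) t :=
    ae_all_iff.2 fun R => (hC R).ae_differentiableWithinAt_of_mem
  obtain ⟨t, htA, ht⟩ : ∃ t ∈ A, ∀ R, t ∈ s R → DifferentiableWithinAt ℝ (p.value R) (s R) t := by
    by_contra! hcon
    refine (hA.measure_pos volume ⟨t₀, hA0⟩).ne' (measure_mono_null (fun t ht => ?_) hae)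
    obtain ⟨R, h1, h2⟩ := hcon t ht
    exact fun h => h2 (h R h1)
  refine ⟨t, fun i => (htA.1 i).1, fun i => (htA.1 i).2, fun R => ?_⟩
  have h1 := Set.mem_iInter.1 htA.2 R
  exact (ht R (interior_subset h1)).differentiableAt (mem_interior_iff_mem_nhds.1 h1)

end ConvexProgram

end ScenarioDRO

/-! ### Perturbing a finite scenario problem -/

theorem IsCompact.convexOn_infDist {E : Type*} [NormedAddCommGroup E] [NormedSpace ℝ E]
    {Y : Set E} (hY : IsCompact Y) (hne : Y.Nonempty) (hc : Convex ℝ Y) :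
    ConvexOn ℝ Set.univ fun x => Metric.infDist x Y := by
  refine ⟨convex_univ, fun x _ y _ a b ha hb hab => ?_⟩
  obtain ⟨u, hu, hxu⟩ := hY.exists_infDist_eq_dist hne x
  obtain ⟨v, hv, hyv⟩ := hY.exists_infDist_eq_dist hne y
  simp only [hxu, hyv]
  calc Metric.infDist (a • x + b • y) Y ≤ dist (a • x + b • y) (a • u + b • v) :=
        Metric.infDist_le_dist_of_mem (hc hu hv ha hb hab)
    _ ≤ dist (a • x) (a • u) + dist (b • y) (b • v) := dist_add_add_le _ _ _ _
    _ = a • dist x u + b • dist y v := by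
        rw [dist_smul₀, dist_smul₀, Real.norm_of_nonneg ha, Real.norm_of_nonneg hb]
        rfl

/-- If nonnegative continuous functions vanish simultaneously on a compact set only where `h`
exceeds `a`, then `h` exceeds `a` also where they are all small. -/
theorem IsCompact.exists_pos_forall_lt_of_le {α κ : Type*} [TopologicalSpace α] {K : Set α}
    (hK : IsCompact K) {g : κ → α → ℝ} (hg : ∀ i, Continuous (g i)) (hg0 : ∀ i x, 0 ≤ g i x)
    {h : α → ℝ} (hh : Continuous h) (s : Finset κ) {a : ℝ}
    (H : ∀ x ∈ K, (∀ i ∈ s, g i x = 0) → a < h x) :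
    ∃ ε > 0, ∀ x ∈ K, (∀ i ∈ s, g i x ≤ ε) → a < h x := by
  have hK' : IsCompact (K ∩ {x | h x ≤ a}) := hK.inter_right (isClosed_le hh continuous_const)
  rcases (K ∩ {x | h x ≤ a}).eq_empty_or_nonempty with he | hne
  · refine ⟨1, one_pos, fun x hx _ => ?_⟩
    by_contra! hle
    exact Set.notMem_empty x (he ▸ ⟨hx, hle⟩)
  · obtain ⟨y, hy, hmin⟩ := hK'.exists_isMinOn hne
      (continuous_finsetSum s fun i _ => hg i).continuousOn
    have hpos : 0 < ∑ i ∈ s, g i y := by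
      refine (Finset.sum_nonneg fun i _ => hg0 i y).lt_of_ne fun h0 => ?_
      rw [eq_comm, Finset.sum_eq_zero_iff_of_nonneg fun i _ => hg0 i y] at h0
      exact absurd (H y hy.1 h0) (not_lt.2 hy.2)
    refine ⟨(∑ i ∈ s, g i y) / (s.card + 1), by positivity, fun x hx hle => ?_⟩
    by_contra! hxa
    have h1 : ∑ i ∈ s, g i y ≤ ∑ i ∈ s, g i x := hmin ⟨hx, hxa⟩
    have h2 : ∑ i ∈ s, g i x ≤ s.card * ((∑ i ∈ s, g i y) / (s.card + 1)) := by
      simpa using Finset.sum_le_card_nsmul s _ _ hle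
    have h3 : s.card * ((∑ i ∈ s, g i y) / (s.card + 1)) < ∑ i ∈ s, g i y := by
      rw [mul_div_assoc', div_lt_iff₀ (by positivity)]
      nlinarith
    linarith

theorem strictConvexOn_inner_add_mul_norm_sq {E : Type*} [NormedAddCommGroup E]
    [InnerProductSpace ℝ E] (c : E) {η : ℝ} (hη : 0 < η) {s : Set E} (hs : Convex ℝ s) :
    StrictConvexOn ℝ s fun x => inner ℝ c x + η * ‖x‖ ^ 2 := by
  have h : StrongConvexOn s (2 * η) fun x => inner ℝ c x + η * ‖x‖ ^ 2 := by
    rw [strongConvexOn_iff_convex]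
    refine ((innerₛₗ ℝ c).convexOn hs).congr fun x _ => ?_
    simp
  exact h.strictConvexOn (by positivity)

namespace ScenarioDRO

open Finset Topology

/-- A finite scenario problem can be perturbed into one that decomposes the sets of constraints
into intervals, without losing a violated constraint. Each constraint set is first shrunk to the
convex hull of the given solutions lying in it, which is compact; this set is then slightly
enlarged, and the objective is made strictly convex. -/
theorem exists_isIntervalDecomposition_of_minimizers {ι E : Type*} [Fintype ι] [DecidableEq ι]
    [NormedAddCommGroup E] [InnerProductSpace ℝ E] [FiniteDimensional ℝ E] (c : E)
    {X : ι → Set E} (hX : ∀ i, Convex ℝ (X i)) {z : Finset ι → E}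
    (hz : ∀ R, ∀ i ∈ R, z R ∈ X i)
    (hmin : ∀ R : Finset ι, R.Nonempty → ∀ x, (∀ i ∈ R, x ∈ X i) →
      inner ℝ c (z R) ≤ inner ℝ c x) :
    ∃ S V, IsIntervalDecomposition (Module.finrank ℝ E) S V ∧
      ∀ R : Finset ι, R.Nonempty → ∀ i,
        inner ℝ c (z R) < inner ℝ c (z (insert i R)) → i ∈ V R := by
  let Y : ι → Set E := fun i => convexHull ℝ (z '' {R | i ∈ R})
  let Z : Set E := convexHull ℝ (Set.range z)
  let g : ι → E → ℝ := fun i x => Metric.infDist x (Y i)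
  have hYc : ∀ i, IsCompact (Y i) := fun i => (Set.toFinite _).isCompact_convexHull (𝕜 := ℝ)
  have hZc : IsCompact Z := (Set.finite_range z).isCompact_convexHull (𝕜 := ℝ)
  have hzY : ∀ R, ∀ i ∈ R, z R ∈ Y i := fun R i hi => subset_convexHull ℝ _ ⟨R, hi, rfl⟩
  have hzZ : ∀ R, z R ∈ Z := fun R => subset_convexHull ℝ _ ⟨R, rfl⟩
  have hYX : ∀ i, Y i ⊆ X i := fun i =>
    convexHull_min (by rintro _ ⟨R, hi, rfl⟩; exact hz R i hi) (hX i)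
  have hYne : ∀ i, (Y i).Nonempty := fun i => ⟨_, hzY univ i (mem_univ i)⟩
  have hg : ∀ i, Continuous (g i) := fun i => Metric.continuous_infDist_pt _
  have hg0 : ∀ i x, 0 ≤ g i x := fun i x => Metric.infDist_nonneg
  have hgz : ∀ R, ∀ i ∈ R, g i (z R) = 0 := fun R i hi => Metric.infDist_zero_of_mem (hzY R i hi)
  have hgY : ∀ i x, g i x = 0 → x ∈ Y i := fun i x h =>
    ((hYc i).isClosed.mem_iff_infDist_zero (hYne i)).2 h
  have hc : Continuous fun x : E => (inner ℝ c x : ℝ) := by fun_prop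
  -- for a violated constraint the optimal value stays larger under small perturbations
  have hgap : ∀ q : Finset ι × ι, ∃ ε > 0, ∃ η > 0, q.1.Nonempty →
      inner ℝ c (z q.1) < inner ℝ c (z (insert q.2 q.1)) → ∀ η' ≤ η, ∀ x ∈ Z,
        (∀ i ∈ insert q.2 q.1, g i x ≤ ε) → inner ℝ c (z q.1) + η' * ‖z q.1‖ ^ 2 < inner ℝ c x := by
    rintro ⟨R, i⟩
    by_cases hlt : R.Nonempty ∧ inner ℝ c (z R) < inner ℝ c (z (insert i R))
    · obtain ⟨a, ha1, ha2⟩ := exists_between hlt.2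
      obtain ⟨ε, hε, H⟩ := hZc.exists_pos_forall_lt_of_le hg hg0 hc (insert i R) (a := a)
        fun x _ hx => ha2.trans_le
          (hmin _ (insert_nonempty i R) x fun k hk => hYX k (hgY k x (hx k hk)))
      refine ⟨ε, hε, (a - inner ℝ c (z R)) / (‖z R‖ ^ 2 + 1),
        div_pos (sub_pos.2 ha1) (by positivity), fun _ _ η' hη' x hx hxg => ?_⟩
      have h1 := H x hx hxg
      rw [le_div_iff₀ (by positivity)] at hη'
      rcases le_or_gt η' 0 with h0 | h0
      · have : η' * ‖z R‖ ^ 2 ≤ 0 := mul_nonpos_of_nonpos_of_nonneg h0 (by positivity)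
        dsimp only
        linarith
      · dsimp only
        linarith
    · exact ⟨1, one_pos, 1, one_pos, fun h1 h2 => absurd ⟨h1, h2⟩ hlt⟩
  choose ε hε η hη H using hgap
  have hlow : ∀ f : Finset ι × ι → ℝ, (∀ q, 0 < f q) → ∃ b > 0, ∀ q, b ≤ f q := by
    intro f hf
    rcases isEmpty_or_nonempty (Finset ι × ι) with he | hne
    · exact ⟨1, one_pos, fun q => he.elim q⟩
    · exact ⟨_, (lt_inf'_iff univ_nonempty).2 fun q _ => hf q, fun q => inf'_le f (mem_univ q)⟩
  obtain ⟨ε₀, hε₀, hεle⟩ := hlow ε hε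
  obtain ⟨η₀, hη₀, hηle⟩ := hlow η hη
  let p : ConvexProgram ι E :=
    { domain := Z
      constraint := g
      objective := fun x => inner ℝ c x + η₀ * ‖x‖ ^ 2
      isCompact_domain := hZc
      convexOn_constraint := fun i => ((hYc i).convexOn_infDist (hYne i)
        (convex_convexHull ℝ _)).subset (Set.subset_univ _) (convex_convexHull ℝ _)
      continuousOn_constraint := fun i => (hg i).continuousOn
      strictConvexOn_objective :=
        strictConvexOn_inner_add_mul_norm_sq c hη₀ (convex_convexHull ℝ _)
      continuousOn_objective := by fun_prop
      center := z univ
      center_mem := hzZ univ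
      constraint_center := fun i => (hgz univ i (mem_univ i)).le }
  obtain ⟨t, ht, htε, hd⟩ := p.exists_differentiableAt_value hε₀
  have ht0 : 0 ≤ t := fun i => (ht i).le
  obtain ⟨S, V, hSV, hV⟩ := p.exists_isIntervalDecomposition ht hd
  refine ⟨S, V, hSV, fun R hR i hlt => hV R i ?_⟩
  have hmem := ConvexProgram.solution_mem (p := p) (R := insert i R) ht0
  calc p.value R t ≤ p.objective (z R) :=
        ConvexProgram.value_le ht0 ⟨hzZ R, fun k hk => (hgz R k hk).le.trans (ht k).le⟩
    _ < inner ℝ c (p.solution (insert i R) t) :=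
        H (R, i) hR hlt η₀ (hηle _) _ hmem.1 fun k hk =>
          (hmem.2 k hk).trans ((htε k).le.trans (hεle _))
    _ ≤ p.value (insert i R) t := le_add_of_nonneg_right (by positivity)

end ScenarioDRO

/-! ### Limits of large samples -/

open Filter Topology in
theorem Nat.tendsto_choose_div_pow {a : ℕ → ℕ} {x : ℝ}
    (h : Tendsto (fun k : ℕ => (a k : ℝ) / k) atTop (𝓝 x)) (i : ℕ) :
    Tendsto (fun k : ℕ => ((a k).choose i : ℝ) / (k : ℝ) ^ i) atTop (𝓝 (x ^ i / i.factorial)) := by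
  induction i with
  | zero => simp
  | succ i ih =>
    have hsub : Tendsto (fun k : ℕ => ((a k - i : ℕ) : ℝ) / k) atTop (𝓝 x) := by
      have h0 : Tendsto (fun k : ℕ => (a k : ℝ) / k - i / k) atTop (𝓝 (x - 0)) :=
        h.sub (tendsto_const_div_atTop_nhds_zero_nat _)
      rw [sub_zero] at h0
      refine tendsto_of_tendsto_of_tendsto_of_le_of_le h0 h (fun k => ?_) fun k => ?_
      · dsimp only
        rw [← sub_div]
        gcongr
        rw [sub_le_iff_le_add]
        exact_mod_cast (by omega : a k ≤ a k - i + i)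
      · dsimp only
        gcongr
        exact Nat.sub_le _ _
    have h1 := (ih.mul hsub).div_const ((i : ℝ) + 1)
    refine (h1.congr fun k => ?_).trans_eq ?_
    · have h2 : ((a k).choose (i + 1) : ℝ) * ((i : ℝ) + 1)
          = (a k).choose i * ((a k - i : ℕ) : ℝ) := by
        exact_mod_cast Nat.choose_succ_right_eq (a k) i
      rw [_root_.div_mul_div_comm, ← _root_.pow_succ, ← h2, div_div, mul_comm _ ((i : ℝ) + 1),
        mul_comm ((k : ℝ) ^ (i + 1)), mul_div_mul_left _ _ (by positivity)]
    · rw [Nat.factorial_succ]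
      congr 1
      push_cast
      field_simp
      ring

open Filter Topology in
/-- The hypergeometric distribution converges to the binomial distribution when the population
grows. -/
theorem tendsto_hypergeometric (N e : ℕ) (hN : e ≤ N) {δ : ℝ} (h0 : 0 < δ) (h1 : δ < 1) :
    Tendsto (fun k : ℕ => ((∑ i ∈ Finset.range (e + 1), (e + ⌊δ * k⌋₊).choose i *
        (N + k - (e + ⌊δ * k⌋₊)).choose (N - i) : ℕ) : ℝ) / ((N + k).choose N : ℝ)) atTop
      (𝓝 (∑ i ∈ Finset.range (e + 1), (N.choose i : ℝ) * δ ^ i * (1 - δ) ^ (N - i))) := by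
  have hc : ∀ b : ℕ, Tendsto (fun k : ℕ => (b : ℝ) / k) atTop (𝓝 0) := fun b =>
    tendsto_const_div_atTop_nhds_zero_nat _
  have hfloor : Tendsto (fun k : ℕ => (⌊δ * k⌋₊ : ℝ) / k) atTop (𝓝 δ) :=
    (tendsto_nat_floor_mul_div_atTop h0.le).comp tendsto_natCast_atTop_atTop
  have hone : Tendsto (fun k : ℕ => (k : ℝ) / k) atTop (𝓝 1) :=
    tendsto_const_nhds.congr' <| (eventually_ne_atTop 0).mono fun k hk =>
      (div_self (Nat.cast_ne_zero.2 hk)).symm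
  have hm : Tendsto (fun k : ℕ => ((e + ⌊δ * k⌋₊ : ℕ) : ℝ) / k) atTop (𝓝 δ) := by
    have := (hc e).add hfloor
    rw [zero_add] at this
    exact this.congr fun k => by push_cast; ring
  have hn : Tendsto (fun k : ℕ => ((N + k : ℕ) : ℝ) / k) atTop (𝓝 1) := by
    have := (hc N).add hone
    rw [zero_add] at this
    exact this.congr fun k => by push_cast; ring
  have hle : ∀ k : ℕ, e + ⌊δ * k⌋₊ ≤ N + k := fun k => by
    have : ⌊δ * k⌋₊ ≤ k := Nat.floor_le_of_le (by nlinarith [Nat.cast_nonneg (α := ℝ) k])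
    omega
  have hr : Tendsto (fun k : ℕ => ((N + k - (e + ⌊δ * k⌋₊) : ℕ) : ℝ) / k) atTop (𝓝 (1 - δ)) :=
    (hn.sub hm).congr fun k => by rw [Nat.cast_sub (hle k)]; ring
  have hsum := tendsto_finsetSum (Finset.range (e + 1)) fun i _ =>
    ((Nat.tendsto_choose_div_pow hm i).mul (Nat.tendsto_choose_div_pow hr (N - i))).div
      (Nat.tendsto_choose_div_pow hn N) (by positivity)
  refine (hsum.congr' ?_).trans_eq ?_
  · filter_upwards [eventually_ne_atTop 0] with k hk
    have hk' : (k : ℝ) ≠ 0 := Nat.cast_ne_zero.2 hk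
    push_cast
    rw [Finset.sum_div]
    refine Finset.sum_congr rfl fun i hi => ?_
    have hi' : i ≤ N := by rw [Finset.mem_range] at hi; omega
    rw [Pi.div_apply, div_mul_div_comm, ← pow_add, Nat.add_sub_cancel' hi',
      div_div_div_cancel_right₀]
    exact pow_ne_zero _ hk'
  · congr 1
    refine Finset.sum_congr rfl fun i hi => ?_
    have hi' : i ≤ N := by rw [Finset.mem_range] at hi; omega
    rw [Nat.cast_choose ℝ hi']
    simp only [one_pow]
    field_simp

namespace ScenarioDRO

open Filter Topology

/-- If the points of `G` almost surely lie in all but finitely many of the `B k`, then the measure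
of `G` is at most the limit of bounds for the measures of the `B k`. -/
theorem measure_le_of_eventually_mem {Ω : Type*} [MeasurableSpace Ω] {π : Measure Ω} {G : Set Ω}
    {B : ℕ → Set Ω} {b : ℕ → ℝ≥0∞} {L : ℝ≥0∞} (hG : ∀ᵐ ω ∂π, ω ∈ G → ∀ᶠ k in atTop, ω ∈ B k)
    (hb : ∀ k, π (B k) ≤ b k) (hL : Tendsto b atTop (𝓝 L)) : π G ≤ L := by
  have hmono : Monotone fun K : ℕ => ⋂ k ≥ K, B k := fun K K' h =>
    Set.biInter_subset_biInter_left fun k hk => le_trans h hk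
  calc π G ≤ π (⋃ K : ℕ, ⋂ k ≥ K, B k) := by
        refine measure_mono_ae ?_
        filter_upwards [hG] with ω hω hωG
        obtain ⟨K, hK⟩ := eventually_atTop.1 (hω hωG)
        exact Set.mem_iUnion.2 ⟨K, Set.mem_iInter₂.2 hK⟩
    _ = ⨆ K : ℕ, π (⋂ k ≥ K, B k) := hmono.measure_iUnion
    _ ≤ L := iSup_le fun K => ge_of_tendsto hL <| (eventually_ge_atTop K).mono fun k hk =>
        (measure_mono (Set.biInter_subset_of_mem hk)).trans (hb k)

variable {𝒴 : Type*} [MeasurableSpace 𝒴] (μ : Measure 𝒴) [IsProbabilityMeasure μ]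

open Classical in
/-- The strong law of large numbers for the relative frequency of `A`. -/
theorem ae_eventually_floor_le_card {A : Set 𝒴} (hA : MeasurableSet A) {δ : ℝ} (hδ : 0 ≤ δ)
    (h : ENNReal.ofReal δ < μ A) : ∀ᵐ u ∂Measure.infinitePi fun _ : ℕ => μ,
      ∀ᶠ k : ℕ in atTop, ⌊δ * k⌋₊ ≤ Finset.card {i : Fin k | u i ∈ A} := by
  let Y : 𝒴 → ℝ := A.indicator 1
  have hY : Measurable Y := measurable_one.indicator hA
  have hae := strong_law_ae_real (μ := Measure.infinitePi fun _ : ℕ => μ) (fun i u => Y (u i))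
    ((measurePreserving_eval_infinitePi (fun _ : ℕ => μ) 0).integrable_comp_of_integrable
      ((integrable_const (1 : ℝ)).indicator hA))
    (fun i j hij => (iIndepFun_infinitePi (P := fun _ : ℕ => μ) fun _ => hY).indepFun hij)
    (fun i => IdentDistrib.comp (u := Y)
      ⟨(measurable_pi_apply i).aemeasurable, (measurable_pi_apply 0).aemeasurable, by
        rw [Measure.infinitePi_map_eval, Measure.infinitePi_map_eval]⟩ hY)
  have hint : ∫ u, Y (u 0) ∂Measure.infinitePi (fun _ : ℕ => μ) = μ.real A := by
    rw [← integral_indicator_one hA]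
    have h1 := integral_map (μ := Measure.infinitePi fun _ : ℕ => μ)
      (measurable_pi_apply 0).aemeasurable hY.aestronglyMeasurable
    rw [Measure.infinitePi_map_eval] at h1
    exact h1.symm
  rw [hint] at hae
  have hlt : δ < μ.real A := (ENNReal.ofReal_lt_iff_lt_toReal hδ (measure_ne_top μ A)).1 h
  filter_upwards [hae] with u hu
  filter_upwards [hu.eventually_const_lt hlt, eventually_gt_atTop 0] with k hk hk0
  refine Nat.floor_le_of_le ?_
  rw [lt_div_iff₀ (Nat.cast_pos.2 hk0), Finset.sum_range] at hk
  refine hk.le.trans (le_of_eq ?_)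
  rw [Finset.card_filter]
  push_cast
  exact Finset.sum_congr rfl fun i _ => by simp [Y, Set.indicator_apply]

theorem measurePreserving_restrict_fin (k : ℕ) :
    MeasurePreserving (fun (u : ℕ → 𝒴) (i : Fin k) => u i) (Measure.infinitePi fun _ => μ)
      (Measure.pi fun _ => μ) := by
  refine ⟨by fun_prop, ?_⟩
  rw [← Measure.infinitePi_eq_pi]
  exact Measure.map_infinitePi_infinitePi_of_inj (P := fun _ : ℕ => μ) Fin.val_injective

/-- A sample of size `N` followed by the first `k` terms of a sequence is a sample of size
`N + k`. -/
theorem measurePreserving_append (N k : ℕ) :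
    MeasurePreserving (fun ω : (Fin N → 𝒴) × (ℕ → 𝒴) => Fin.append ω.1 fun i : Fin k => ω.2 i)
      ((Measure.pi fun _ => μ).prod (Measure.infinitePi fun _ => μ)) (Measure.pi fun _ => μ) := by
  have hmeas : Measurable fun ω : (Fin N → 𝒴) × (ℕ → 𝒴) =>
      Fin.append ω.1 fun i : Fin k => ω.2 i := by
    refine measurable_pi_lambda _ fun i => ?_
    induction i using Fin.addCases with
    | left i => simp only [Fin.append_left]; fun_prop
    | right i => simp only [Fin.append_right]; fun_prop
  refine ⟨hmeas, (Measure.pi_eq fun t ht => ?_).symm⟩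
  rw [Measure.map_apply hmeas (.univ_pi ht)]
  have hset : (fun ω : (Fin N → 𝒴) × (ℕ → 𝒴) => Fin.append ω.1 fun i : Fin k => ω.2 i) ⁻¹'
      Set.univ.pi t = (Set.univ.pi fun i => t (Fin.castAdd k i)) ×ˢ
        ((fun (u : ℕ → 𝒴) (i : Fin k) => u i) ⁻¹' Set.univ.pi fun i => t (Fin.natAdd N i)) := by
    ext ω
    simp only [Set.mem_preimage, Set.mem_univ_pi, Set.mem_prod]
    constructor
    · intro h
      exact ⟨fun i => by simpa using h (Fin.castAdd k i),
        fun i => by simpa using h (Fin.natAdd N i)⟩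
    · rintro ⟨h1, h2⟩ i
      induction i using Fin.addCases with
      | left i => simpa using h1 i
      | right i => simpa using h2 i
  rw [hset, Measure.prod_prod, (measurePreserving_restrict_fin μ k).measure_preimage
    (MeasurableSet.univ_pi fun i => ht _).nullMeasurableSet,
    Measure.pi_pi, Measure.pi_pi, Fin.prod_univ_add]

end ScenarioDRO

/-! ### The violation probability of a scenario solution -/

namespace ScenarioDRO

open Filter Topology

theorem scenarioRegion_comp_orderEmbOfFin {E 𝒴 : Type*} (𝒳 : Set E) (X : 𝒴 → Set E) {n : ℕ}
    (s : Fin n → 𝒴) (R : Finset (Fin n)) :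
    scenarioRegion 𝒳 X (fun l => s (R.orderEmbOfFin rfl l))
      = {x | x ∈ 𝒳 ∧ ∀ i ∈ R, x ∈ X (s i)} := by
  ext x
  refine and_congr_right fun _ => ⟨fun h i hi => ?_, fun h l => h _ (R.orderEmbOfFin_mem rfl l)⟩
  have hr : i ∈ Set.range (R.orderEmbOfFin rfl) := by rwa [R.range_orderEmbOfFin rfl]
  obtain ⟨l, rfl⟩ := hr
  exact h l

section Problem

variable {𝒴 : Type*} {d : ℕ} {c : EuclideanSpace ℝ (Fin d)} {𝒳 : Set (EuclideanSpace ℝ (Fin d))}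
  {X : 𝒴 → Set (EuclideanSpace ℝ (Fin d))}
  {xhat : (m : ℕ) → (Fin m → 𝒴) → EuclideanSpace ℝ (Fin d)}

open Classical in
/-- Among the `r`-element subsamples of a given sample, those whose solution violates at least `j`
constraints of the sample are counted by the combinatorial bound. -/
theorem card_violating_subsamples_le {e : ℕ} (hd : d = e + 1) (hX_sub : ∀ ξ, X ξ ⊆ 𝒳)
    (hX_convex : ∀ ξ, Convex ℝ (X ξ))
    (h_unique : ∀ m : ℕ, 1 ≤ m → ∀ s : Fin m → 𝒴, ∃! x, IsScenarioSolution c 𝒳 X s x)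
    (hxhat : ∀ m : ℕ, 1 ≤ m → ∀ s : Fin m → 𝒴, IsScenarioSolution c 𝒳 X s (xhat m s))
    {n r j : ℕ} (s : Fin n → 𝒴) (hr : e + 1 ≤ r) (hn : e + 1 ≤ n) (hj : e + j ≤ n) :
    Finset.card {R : Finset (Fin n) | R.card = r ∧ j ≤ Finset.card
        {i | xhat R.card (fun l => s (R.orderEmbOfFin rfl l)) ∉ X (s i)}}
      ≤ ∑ i ∈ Finset.range (e + 1), (e + j).choose i * (n - (e + j)).choose (r - i) := by
  let z : Finset (Fin n) → EuclideanSpace ℝ (Fin d) := fun R =>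
    xhat R.card fun l => s (R.orderEmbOfFin rfl l)
  have hsol : ∀ R : Finset (Fin n), R.Nonempty →
      IsScenarioSolution c 𝒳 X (fun l => s (R.orderEmbOfFin rfl l)) (z R) := fun R hR =>
    hxhat _ (Finset.card_pos.2 hR) _
  have hz : ∀ R : Finset (Fin n), R.Nonempty → z R ∈ 𝒳 ∧ ∀ i ∈ R, z R ∈ X (s i) := by
    intro R hR
    have := (hsol R hR).1
    rwa [scenarioRegion_comp_orderEmbOfFin] at this
  have hmin : ∀ R : Finset (Fin n), R.Nonempty → ∀ x, (∀ i ∈ R, x ∈ X (s i)) →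
      inner ℝ c (z R) ≤ inner ℝ c x := by
    intro R hR x hx
    refine (hsol R hR).2 x ?_
    rw [scenarioRegion_comp_orderEmbOfFin]
    obtain ⟨i, hi⟩ := hR
    exact ⟨hX_sub _ (hx i hi), hx⟩
  obtain ⟨S, V, hSV, hV⟩ := exists_isIntervalDecomposition_of_minimizers c
    (fun i => hX_convex (s i)) (fun R i hi => (hz R ⟨i, hi⟩).2 i hi) hmin
  rw [finrank_euclideanSpace, Fintype.card_fin] at hSV
  subst hd
  have hviol : ∀ R : Finset (Fin n), R.Nonempty → ∀ i, z R ∉ X (s i) → i ∈ V R := by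
    intro R hR i hi
    refine hV R hR i (lt_of_not_ge fun hle => hi ?_)
    have hins := hz (insert i R) (Finset.insert_nonempty i R)
    -- otherwise the solution for the larger subsample is another solution for `R`
    have hopt : IsScenarioSolution c 𝒳 X (fun l => s (R.orderEmbOfFin rfl l)) (z (insert i R)) := by
      refine ⟨?_, fun y hy => hle.trans ((hsol R hR).2 y hy)⟩
      rw [scenarioRegion_comp_orderEmbOfFin]
      exact ⟨hins.1, fun k hk => hins.2 k (Finset.mem_insert_of_mem hk)⟩
    rw [(h_unique _ (Finset.card_pos.2 hR) _).unique (hsol R hR) hopt]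
    exact hins.2 i (Finset.mem_insert_self i R)
  have hbound := hSV.card_le_sum_choose (r := r) (j := j) hr (by simpa using hj) (by simpa using hn)
  rw [Fintype.card_fin] at hbound
  refine le_trans (Finset.card_le_card fun R => ?_) hbound
  simp only [Finset.mem_filter, Finset.mem_univ, true_and]
  rintro ⟨h1, h2⟩
  refine ⟨h1, h2.trans (Finset.card_le_card fun i hi => ?_)⟩
  exact hviol R (Finset.card_pos.1 (by omega)) i (by simpa using hi)

open Classical in
variable (X xhat) in
/-- The samples of size `N + k` of which at least `j` violate the solution for the first `N`. -/
def violationEvent (N k j : ℕ) : Set (Fin (N + k) → 𝒴) :=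
  {s | j ≤ Finset.card {i | xhat N (fun l => s (Fin.castAdd k l)) ∉ X (s i)}}

theorem measurableSet_violationEvent [MeasurableSpace 𝒴]
    (hX_meas : MeasurableSet {p : EuclideanSpace ℝ (Fin d) × 𝒴 | p.1 ∈ X p.2})
    (hxhat_meas : ∀ m : ℕ, Measurable (xhat m)) (N k j : ℕ) :
    MeasurableSet (violationEvent X xhat N k j) := by
  classical
  have hsum : Measurable fun s : Fin (N + k) → 𝒴 => ∑ i, if xhat N (fun l => s (Fin.castAdd k l)) ∉
      X (s i) then 1 else 0 := by
    refine Finset.measurable_sum _ fun i _ => Measurable.ite ?_ measurable_const measurable_const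
    have hpair : Measurable fun s : Fin (N + k) → 𝒴 =>
        (xhat N (fun l => s (Fin.castAdd k l)), s i) :=
      ((hxhat_meas N).comp (by fun_prop)).prodMk (measurable_pi_apply i)
    exact (hpair hX_meas).compl
  have heq : violationEvent X xhat N k j = {s | j ≤ ∑ i, if xhat N (fun l => s (Fin.castAdd k l)) ∉
      X (s i) then 1 else 0} := by
    ext s
    rw [violationEvent, Set.mem_ofPred_eq, Set.mem_ofPred_eq, Finset.card_filter]
  rw [heq]
  exact measurableSet_le measurable_const hsum

/-- As the samples are exchangeable, the probability that at least `j` of them violate the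
solution for the first `N` is an average over all the subsamples of size `N`. -/
theorem choose_mul_measure_violationEvent_le [MeasurableSpace 𝒴] (μ : Measure 𝒴)
    [IsProbabilityMeasure μ] {e : ℕ} (hd : d = e + 1) (hX_sub : ∀ ξ, X ξ ⊆ 𝒳)
    (hX_convex : ∀ ξ, Convex ℝ (X ξ))
    (hX_meas : MeasurableSet {p : EuclideanSpace ℝ (Fin d) × 𝒴 | p.1 ∈ X p.2})
    (h_unique : ∀ m : ℕ, 1 ≤ m → ∀ s : Fin m → 𝒴, ∃! x, IsScenarioSolution c 𝒳 X s x)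
    (hxhat : ∀ m : ℕ, 1 ≤ m → ∀ s : Fin m → 𝒴, IsScenarioSolution c 𝒳 X s (xhat m s))
    (hxhat_meas : ∀ m : ℕ, Measurable (xhat m))
    {N k j : ℕ} (hN : e + 1 ≤ N) (hj : e + j ≤ N + k) :
    ((N + k).choose N : ℝ≥0∞) * Measure.pi (fun _ => μ) (violationEvent X xhat N k j)
      ≤ ((∑ i ∈ Finset.range (e + 1), (e + j).choose i * (N + k - (e + j)).choose (N - i) : ℕ) :
        ℝ≥0∞) := by
  classical
  let A : Finset (Fin (N + k)) → Set (Fin (N + k) → 𝒴) := fun R =>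
    {s | j ≤ Finset.card {i | xhat R.card (fun l => s (R.orderEmbOfFin rfl l)) ∉ X (s i)}}
  have hA : ∀ R : Finset (Fin (N + k)), R.card = N → MeasurableSet (A R) ∧
      Measure.pi (fun _ => μ) (A R) = Measure.pi (fun _ => μ) (violationEvent X xhat N k j) := by
    intro R hR
    -- a permutation carrying the first `N` indices to `R`
    let F : Finset (Fin (N + k)) := Finset.univ.map (Fin.castAddEmb k)
    have hF : F.card = R.card := by simp [F, hR]
    let σ : Equiv.Perm (Fin (N + k)) := (Finset.equivOfCardEq hF).extendSubtype
    have hσ : ∀ i, i ∈ F ↔ σ i ∈ R := fun i =>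
      ⟨fun h => Equiv.extendSubtype_mem _ i h, fun h => by
        by_contra hi
        exact Equiv.extendSubtype_not_mem (Finset.equivOfCardEq hF) i hi h⟩
    have hregion : ∀ s : Fin (N + k) → 𝒴,
        scenarioRegion 𝒳 X (fun l : Fin N => s (σ (Fin.castAdd k l)))
          = scenarioRegion 𝒳 X fun l => s (R.orderEmbOfFin rfl l) := by
      intro s
      rw [scenarioRegion_comp_orderEmbOfFin]
      ext x
      refine and_congr_right fun _ => ⟨fun h i hi => ?_, fun h l => h _ ((hσ _).1 (by simp [F]))⟩
      have h1 : σ.symm i ∈ F := (hσ _).2 (by simpa using hi)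
      obtain ⟨l, -, hl⟩ := Finset.mem_map.1 h1
      have h2 : x ∈ X (s (σ (Fin.castAdd k l))) := h l
      have h3 : Fin.castAdd k l = σ.symm i := hl
      rwa [h3, σ.apply_symm_apply] at h2
    have hsol : ∀ s : Fin (N + k) → 𝒴, xhat N (fun l => s (σ (Fin.castAdd k l)))
        = xhat R.card fun l => s (R.orderEmbOfFin rfl l) := by
      intro s
      refine (h_unique N (by omega) fun l => s (σ (Fin.castAdd k l))).unique
        (hxhat N (by omega) _) ?_
      have h1 := hxhat R.card (by omega) fun l => s (R.orderEmbOfFin rfl l)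
      rwa [IsScenarioSolution, ← hregion s] at h1
    have hmp : MeasurePreserving (fun (s : Fin (N + k) → 𝒴) i => s (σ i)) (Measure.pi fun _ => μ)
        (Measure.pi fun _ => μ) := by
      refine ⟨by fun_prop, ?_⟩
      rw [← Measure.infinitePi_eq_pi]
      exact Measure.map_infinitePi_infinitePi_of_inj (P := fun _ => μ) σ.injective
    have hpre : A R = (fun (s : Fin (N + k) → 𝒴) i => s (σ i)) ⁻¹' violationEvent X xhat N k j := by
      ext s
      have hcard : Finset.card {i | xhat R.card (fun l => s (R.orderEmbOfFin rfl l)) ∉ X (s i)}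
          = Finset.card {i | xhat R.card (fun l => s (R.orderEmbOfFin rfl l)) ∉ X (s (σ i))} := by
        rw [← Finset.card_map σ.symm.toEmbedding]
        congr 1
        ext i
        simp only [Finset.mem_filter, Finset.mem_univ, true_and, Finset.mem_map_equiv,
          Equiv.symm_symm]
      simp only [A, violationEvent, Set.mem_preimage, Set.mem_ofPred_eq, hsol, hcard]
    have hmeas := measurableSet_violationEvent hX_meas hxhat_meas N k j
    rw [hpre]
    exact ⟨hmp.measurable hmeas, hmp.measure_preimage hmeas.nullMeasurableSet⟩
  have hcard : (Finset.univ.powersetCard N : Finset (Finset (Fin (N + k)))).card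
      = (N + k).choose N := by simp
  calc ((N + k).choose N : ℝ≥0∞) * Measure.pi (fun _ => μ) (violationEvent X xhat N k j)
      = ∑ R ∈ Finset.univ.powersetCard N, Measure.pi (fun _ => μ) (A R) := by
        rw [Finset.sum_congr rfl fun R hR => (hA R (Finset.mem_powersetCard.1 hR).2).2,
          Finset.sum_const, hcard, nsmul_eq_mul]
    _ = ∑ R ∈ Finset.univ.powersetCard N, ∫⁻ s, (A R).indicator 1 s ∂Measure.pi fun _ => μ :=
        Finset.sum_congr rfl fun R hR =>
          (lintegral_indicator_one (hA R (Finset.mem_powersetCard.1 hR).2).1).symm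
    _ = ∫⁻ s, ∑ R ∈ Finset.univ.powersetCard N, (A R).indicator 1 s ∂Measure.pi fun _ => μ :=
        (lintegral_finsetSum' _ fun R hR => (measurable_one.indicator
          (hA R (Finset.mem_powersetCard.1 hR).2).1).aemeasurable).symm
    _ ≤ ∫⁻ _, ((∑ i ∈ Finset.range (e + 1),
          (e + j).choose i * (N + k - (e + j)).choose (N - i) : ℕ) : ℝ≥0∞)
          ∂Measure.pi fun _ : Fin (N + k) => μ := by
        refine lintegral_mono fun s => ?_
        have h1 := card_violating_subsamples_le hd hX_sub hX_convex h_unique hxhat s hN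
          (by omega) hj
        refine le_trans (le_of_eq ?_) (Nat.cast_le.2 h1)
        simp only [Set.indicator_apply, Pi.one_apply]
        rw [Finset.sum_boole]
        congr 2
        ext R
        simp only [A, Finset.mem_filter, Finset.mem_powersetCard, Finset.subset_univ, true_and,
          Finset.mem_univ, Set.mem_ofPred_eq]
    _ = _ := by rw [lintegral_const, measure_univ, mul_one]

/-- The Campi–Garatti bound for the probability that the solution of a scenario program is violated
with probability more than `δ`. The events that at least `⌊δ k⌋` of `k` further samples violate
the solution have, by exchangeability, hypergeometric bounds, which tend to the binomial one. -/
theorem measure_violation_gt_le [MeasurableSpace 𝒴] (μ : Measure 𝒴)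
    [IsProbabilityMeasure μ] {e : ℕ} (hd : d = e + 1) (hX_sub : ∀ ξ, X ξ ⊆ 𝒳)
    (hX_convex : ∀ ξ, Convex ℝ (X ξ))
    (hX_meas : MeasurableSet {p : EuclideanSpace ℝ (Fin d) × 𝒴 | p.1 ∈ X p.2})
    (h_unique : ∀ m : ℕ, 1 ≤ m → ∀ s : Fin m → 𝒴, ∃! x, IsScenarioSolution c 𝒳 X s x)
    (hxhat : ∀ m : ℕ, 1 ≤ m → ∀ s : Fin m → 𝒴, IsScenarioSolution c 𝒳 X s (xhat m s))
    (hxhat_meas : ∀ m : ℕ, Measurable (xhat m))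
    {N : ℕ} (hN : e + 1 ≤ N) {δ : ℝ} (h0 : 0 < δ) (h1 : δ < 1) :
    Measure.pi (fun _ => μ) {s : Fin N → 𝒴 | ENNReal.ofReal δ < μ {ξ | xhat N s ∉ X ξ}}
      ≤ ENNReal.ofReal
        (∑ i ∈ Finset.range (e + 1), (N.choose i : ℝ) * δ ^ i * (1 - δ) ^ (N - i)) := by
  classical
  let π : Measure ((Fin N → 𝒴) × (ℕ → 𝒴)) :=
    (Measure.pi fun _ => μ).prod (Measure.infinitePi fun _ => μ)
  let G : Set (Fin N → 𝒴) := {s | ENNReal.ofReal δ < μ {ξ | xhat N s ∉ X ξ}}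
  let B : ℕ → Set ((Fin N → 𝒴) × (ℕ → 𝒴)) := fun k =>
    (fun ω => Fin.append ω.1 fun i : Fin k => ω.2 i) ⁻¹' violationEvent X xhat N k ⌊δ * k⌋₊
  have hpair : MeasurableSet {p : (Fin N → 𝒴) × 𝒴 | xhat N p.1 ∉ X p.2} :=
    (((hxhat_meas N).comp measurable_fst).prodMk measurable_snd hX_meas).compl
  have hG : MeasurableSet G :=
    measurableSet_lt measurable_const (measurable_measure_prodMk_left hpair)
  have hE : ∀ k, MeasurableSet (violationEvent X xhat N k ⌊δ * k⌋₊) := fun k =>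
    measurableSet_violationEvent hX_meas hxhat_meas N k _
  have hB : ∀ k, MeasurableSet (B k) := fun k => (measurePreserving_append μ N k).measurable (hE k)
  have hae : ∀ᵐ ω ∂π, ω ∈ G ×ˢ Set.univ → ∀ᶠ k in atTop, ω ∈ B k := by
    have hC : MeasurableSet ((G ×ˢ Set.univ)ᶜ ∪ liminf B atTop) :=
      (hG.prod .univ).compl.union (MeasurableSet.measurableSet_liminf hB)
    have hall : ∀ᵐ ω ∂π, ω ∈ (G ×ˢ Set.univ)ᶜ ∪ liminf B atTop := by
      refine (Measure.ae_prod_mem_iff_ae_ae_mem hC).2 (ae_of_all _ fun s => ?_)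
      by_cases hs : s ∈ G
      · filter_upwards [ae_eventually_floor_le_card μ (hpair.preimage measurable_prodMk_left)
          h0.le hs] with u hu
        refine Or.inr (mem_liminf_iff_eventually_mem.2 (hu.mono fun k hk => ?_))
        refine hk.trans ?_
        rw [← Finset.card_map (Fin.natAddEmb N)]
        refine Finset.card_le_card fun i hi => ?_
        obtain ⟨l, hl, rfl⟩ := Finset.mem_map.1 hi
        simpa using hl
      · exact ae_of_all _ fun u => Or.inl fun h => hs h.1
    filter_upwards [hall] with ω hω hωG
    exact mem_liminf_iff_eventually_mem.1 (hω.resolve_left (not_not.2 hωG))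
  have hb : ∀ k, π (B k) ≤ ENNReal.ofReal (((∑ i ∈ Finset.range (e + 1),
      (e + ⌊δ * k⌋₊).choose i * (N + k - (e + ⌊δ * k⌋₊)).choose (N - i) : ℕ) : ℝ) /
        ((N + k).choose N : ℝ)) := by
    intro k
    have hfloor : ⌊δ * k⌋₊ ≤ k := Nat.floor_le_of_le (by nlinarith [Nat.cast_nonneg (α := ℝ) k])
    have hpos : 0 < (N + k).choose N := Nat.choose_pos (Nat.le_add_right N k)
    rw [(measurePreserving_append μ N k).measure_preimage (hE k).nullMeasurableSet,
      ENNReal.ofReal_div_of_pos (Nat.cast_pos.2 hpos), ENNReal.ofReal_natCast,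
      ENNReal.ofReal_natCast, ENNReal.le_div_iff_mul_le (Or.inl (Nat.cast_ne_zero.2 hpos.ne'))
        (Or.inl (ENNReal.natCast_ne_top _)), mul_comm]
    exact choose_mul_measure_violationEvent_le μ hd hX_sub hX_convex hX_meas h_unique hxhat
      hxhat_meas hN (by omega)
  have hlim := measure_le_of_eventually_mem hae hb
    (ENNReal.tendsto_ofReal (tendsto_hypergeometric N e (by omega) h0 h1))
  rwa [Measure.prod_prod, measure_univ, mul_one] at hlim

end Problem

end ScenarioDRO

/-! ### Monte Carlo samples drawn given the data -/

namespace ScenarioDRO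

open Filter Topology

/-- The set whose infimum is `Nexact δ β d` is nonempty, so that `Nexact` is not a junk value. -/
theorem exists_binomialTail_le {δ β : ℝ} (d : ℕ) (hδ : 0 < δ) (hβ : 0 < β) :
    ∃ n : ℕ, ∑ i ∈ Finset.range d, (n.choose i : ℝ) * δ ^ i * (1 - δ) ^ (n - i) ≤ β := by
  rcases lt_or_ge δ 1 with h1 | h1
  · have hterm : ∀ i, Tendsto (fun n : ℕ => (n.choose i : ℝ) * δ ^ i * (1 - δ) ^ (n - i)) atTop
        (𝓝 0) := by
      intro i
      rw [← tendsto_add_atTop_iff_nat i]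
      have h2 : ‖(1 - δ : ℝ)‖ < 1 := by
        rw [Real.norm_eq_abs, abs_lt]
        constructor <;> linarith
      have h3 := (summable_choose_mul_geometric_of_norm_lt_one i h2).tendsto_atTop_zero.const_mul
        (δ ^ i)
      rw [mul_zero] at h3
      refine h3.congr fun n => ?_
      rw [Nat.add_sub_cancel]
      ring
    have hsum := tendsto_finsetSum (Finset.range d) fun i _ => hterm i
    rw [Finset.sum_const_zero] at hsum
    exact ((hsum.eventually_lt_const hβ).mono fun n hn => hn.le).exists
  · -- for `δ ≥ 1` the sum is `1 - δ ^ d` at `n = d`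
    refine ⟨d, ?_⟩
    have h2 := add_pow δ (1 - δ) d
    rw [add_sub_cancel, one_pow, Finset.sum_range_succ, Nat.sub_self, pow_zero, Nat.choose_self,
      mul_one, Nat.cast_one, mul_one] at h2
    have h3 : ∑ i ∈ Finset.range d, (d.choose i : ℝ) * δ ^ i * (1 - δ) ^ (d - i) = 1 - δ ^ d := by
      refine eq_sub_of_add_eq
        ((congrArg (· + δ ^ d) (Finset.sum_congr rfl fun i _ => ?_)).trans h2.symm)
      ring
    rw [h3]
    linarith [one_le_pow₀ h1 (n := d)]

theorem binomialTail_Nexact_le {δ β : ℝ} (d : ℕ) (hδ : 0 < δ) (hβ : 0 < β) :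
    ∑ i ∈ Finset.range d, ((Nexact δ β d).choose i : ℝ) * δ ^ i * (1 - δ) ^ (Nexact δ β d - i)
      ≤ β :=
  Nat.sInf_mem (exists_binomialTail_le d hδ hβ)

theorem le_Nexact {δ β : ℝ} (d : ℕ) (hδ : 0 < δ) (hβ : 0 < β) (hβ1 : β < 1) :
    d ≤ Nexact δ β d := by
  by_contra! hlt
  -- with fewer than `d` samples the sum runs over the whole binomial distribution
  have h2 : ∑ i ∈ Finset.range d, ((Nexact δ β d).choose i : ℝ) * δ ^ i *
      (1 - δ) ^ (Nexact δ β d - i) = 1 := by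
    rw [← Finset.sum_subset (Finset.range_subset_range.2 hlt) fun i _ hi => by
      rw [Finset.mem_range, not_lt] at hi
      rw [Nat.choose_eq_zero_of_lt hi, Nat.cast_zero, zero_mul, zero_mul]]
    have h3 := add_pow δ (1 - δ) (Nexact δ β d)
    rw [add_sub_cancel, one_pow] at h3
    refine (Finset.sum_congr rfl fun i _ => ?_).trans h3.symm
    ring
  linarith [binomialTail_Nexact_le d hδ hβ]

theorem measurable_Nexact {Δ : Type*} [MeasurableSpace Δ] {δ : Δ → ℝ} (hδ_meas : Measurable δ)
    (hδ : ∀ D, 0 < δ D) {β : ℝ} (hβ : 0 < β) (d : ℕ) :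
    Measurable fun D => Nexact (δ D) β d := by
  classical
  have h := measurable_find (fun D => exists_binomialTail_le d (hδ D) hβ) fun k =>
    measurableSet_le (f := fun D => ∑ i ∈ Finset.range d, (k.choose i : ℝ) * δ D ^ i *
      (1 - δ D) ^ (k - i)) (by fun_prop) measurable_const
  have heq : (fun D => Nexact (δ D) β d) = fun D => Nat.find (exists_binomialTail_le d (hδ D) hβ) :=
    funext fun D => Nat.sInf_def (exists_binomialTail_le d (hδ D) hβ)
  rwa [heq]

theorem ofReal_one_sub_le_measure {Ω : Type*} [MeasurableSpace Ω] {μ : Measure Ω}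
    [IsProbabilityMeasure μ] {A : Set Ω} (hA : MeasurableSet A) {a : ℝ} (ha : 0 ≤ a)
    (h : μ Aᶜ ≤ ENNReal.ofReal a) : ENNReal.ofReal (1 - a) ≤ μ A := by
  rw [ENNReal.ofReal_sub _ ha, ENNReal.ofReal_one, tsub_le_iff_right]
  calc 1 = μ A + μ Aᶜ := (prob_add_prob_compl hA).symm
    _ ≤ _ := by gcongr

/-- A point violated with probability at most `δ` under `P₀` is violated with probability at most
`boundM P₀ U δ` under each member of `U`. -/
theorem ofReal_one_sub_le_of_boundM_le {E 𝒴 : Type*} [MeasurableSpace 𝒴] {X : 𝒴 → Set E} {x : E}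
    (hx : MeasurableSet {ξ | x ∈ X ξ}) {P₀ : Measure 𝒴} {U : Set (ProbabilityMeasure 𝒴)} {δ ε : ℝ}
    (hε : 0 ≤ ε) (hM : boundM P₀ U δ ≤ ENNReal.ofReal ε)
    (h : P₀ {ξ | x ∉ X ξ} ≤ ENNReal.ofReal δ) {Q : ProbabilityMeasure 𝒴} (hQ : Q ∈ U) :
    ENNReal.ofReal (1 - ε) ≤ (Q : Measure 𝒴) {ξ | x ∈ X ξ} := by
  refine ofReal_one_sub_le_measure hx hε (le_trans ?_ hM)
  exact le_iSup₂_of_le Q hQ (le_iSup₂_of_le {ξ | x ∉ X ξ} ⟨hx.compl, h⟩ le_rfl)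

section Problem

variable {𝒴 : Type*} {d : ℕ} {c : EuclideanSpace ℝ (Fin d)}
  {𝒳 : Set (EuclideanSpace ℝ (Fin d))} {X : 𝒴 → Set (EuclideanSpace ℝ (Fin d))}
  {xhat : (m : ℕ) → (Fin m → 𝒴) → EuclideanSpace ℝ (Fin d)}

/-- When `d = 0` there may be no samples at all, but then the space is a single point. -/
theorem xhat_Nexact_mem [Nonempty 𝒴]
    (hxhat : ∀ m : ℕ, 1 ≤ m → ∀ s : Fin m → 𝒴, IsScenarioSolution c 𝒳 X s (xhat m s))
    {δ β : ℝ} (hδ : 0 < δ) (hβ : 0 < β) (hβ1 : β < 1) (s : Fin (Nexact δ β d) → 𝒴) :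
    xhat (Nexact δ β d) s ∈ 𝒳 := by
  rcases Nat.eq_zero_or_pos d with rfl | hd
  · obtain ⟨ξ⟩ := ‹Nonempty 𝒴›
    have h := (hxhat 1 le_rfl fun _ => ξ).1.1
    rwa [Subsingleton.elim (xhat 1 fun _ => ξ) (xhat (Nexact δ β 0) s)] at h
  · exact (hxhat _ (le_trans hd (le_Nexact d hδ hβ hβ1)) s).1.1

variable [MeasurableSpace 𝒴]

/-- The violation bound with `Nexact δ β d` samples. For `δ < 1` and `0 < d` this is the
Campi–Garatti bound; a probability never exceeds `δ ≥ 1`, and in dimension `0` no constraint is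
violated. -/
theorem measure_violation_Nexact_le (μ : Measure 𝒴) [IsProbabilityMeasure μ]
    (hX_sub : ∀ ξ, X ξ ⊆ 𝒳) (hX_convex : ∀ ξ, Convex ℝ (X ξ))
    (hX_meas : MeasurableSet {p : EuclideanSpace ℝ (Fin d) × 𝒴 | p.1 ∈ X p.2})
    (h_unique : ∀ m : ℕ, 1 ≤ m → ∀ s : Fin m → 𝒴, ∃! x, IsScenarioSolution c 𝒳 X s x)
    (hxhat : ∀ m : ℕ, 1 ≤ m → ∀ s : Fin m → 𝒴, IsScenarioSolution c 𝒳 X s (xhat m s))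
    (hxhat_meas : ∀ m : ℕ, Measurable (xhat m))
    {δ β : ℝ} (hδ : 0 < δ) (hβ : 0 < β) (hβ1 : β < 1) :
    Measure.pi (fun _ => μ) {s : Fin (Nexact δ β d) → 𝒴 |
      ENNReal.ofReal δ < μ {ξ | xhat (Nexact δ β d) s ∉ X ξ}} ≤ ENNReal.ofReal β := by
  rcases lt_or_ge δ 1 with h1 | h1
  · obtain _ | e := d
    · have hempty : {s : Fin (Nexact δ β 0) → 𝒴 |
          ENNReal.ofReal δ < μ {ξ | xhat (Nexact δ β 0) s ∉ X ξ}} = ∅ := by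
        refine Set.eq_empty_of_forall_notMem fun s hs =>
          not_lt_zero (a := ENNReal.ofReal δ) ?_
        refine lt_of_lt_of_eq hs (measure_mono_null (t := ∅) (fun ξ hξ => hξ ?_) measure_empty)
        have h := (hxhat 1 le_rfl fun _ => ξ).1.2 0
        rwa [Subsingleton.elim (xhat 1 fun _ => ξ) (xhat (Nexact δ β 0) s)] at h
      rw [hempty, measure_empty]
      exact zero_le
    · exact (measure_violation_gt_le μ rfl hX_sub hX_convex hX_meas h_unique hxhat hxhat_meas
        (le_Nexact _ hδ hβ hβ1) hδ h1).trans
        (ENNReal.ofReal_le_ofReal (binomialTail_Nexact_le _ hδ hβ))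
  · have hempty : {s : Fin (Nexact δ β d) → 𝒴 |
        ENNReal.ofReal δ < μ {ξ | xhat (Nexact δ β d) s ∉ X ξ}} = ∅ := by
      refine Set.eq_empty_of_forall_notMem fun s hs => ?_
      have h2 : μ {ξ | xhat (Nexact δ β d) s ∉ X ξ} ≤ ENNReal.ofReal δ :=
        prob_le_one.trans (by rwa [ENNReal.one_le_ofReal])
      exact absurd hs (not_lt.2 h2)
    rw [hempty, measure_empty]
    exact zero_le

variable {n : ℕ} (P : ProbabilityMeasure 𝒴) (P₀ : Kernel (Fin n → 𝒴) 𝒴) [IsMarkovKernel P₀]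

instance : IsProbabilityMeasure (jointLaw P n P₀) := by
  unfold jointLaw
  infer_instance

variable (X xhat) in
/-- The event that, given the data, the Monte Carlo solution is violated with probability at most
`δ` under the generating distribution. -/
def goodEvent (δ : (Fin n → 𝒴) → ℝ) (β : ℝ) : Set ((Fin n → 𝒴) × (ℕ → 𝒴)) :=
  {ω | P₀ ω.1 {ξ | xhat (Nexact (δ ω.1) β d) (fun i => ω.2 i) ∉ X ξ} ≤ ENNReal.ofReal (δ ω.1)}

theorem measurableSet_goodEvent
    (hX_meas : MeasurableSet {p : EuclideanSpace ℝ (Fin d) × 𝒴 | p.1 ∈ X p.2})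
    (hxhat_meas : ∀ m : ℕ, Measurable (xhat m)) {δ : (Fin n → 𝒴) → ℝ} (hδ_meas : Measurable δ)
    (hδ : ∀ D, 0 < δ D) {β : ℝ} (hβ : 0 < β) : MeasurableSet (goodEvent X xhat P₀ δ β) := by
  have hΦ : Measurable fun ω : (Fin n → 𝒴) × (ℕ → 𝒴) =>
      xhat (Nexact (δ ω.1) β d) fun i => ω.2 i := by
    have h1 : Measurable fun q : ℕ × (ℕ → 𝒴) => xhat q.1 fun i => q.2 i :=
      measurable_from_prod_countable_right fun m => (hxhat_meas m).comp (by fun_prop)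
    exact h1.comp (((measurable_Nexact hδ_meas hδ hβ d).comp measurable_fst).prodMk measurable_snd)
  have hset : MeasurableSet {q : ((Fin n → 𝒴) × (ℕ → 𝒴)) × 𝒴 |
      xhat (Nexact (δ q.1.1) β d) (fun i => q.1.2 i) ∉ X q.2} :=
    ((hΦ.comp measurable_fst).prodMk measurable_snd hX_meas).compl
  have hker := Kernel.measurable_kernel_prodMk_left (κ := P₀.comap Prod.fst measurable_fst) hset
  exact measurableSet_le hker (hδ_meas.comp measurable_fst).ennreal_ofReal

/-- The Monte Carlo bound holds for each value of the data, hence also jointly. -/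
theorem jointLaw_compl_goodEvent_le (hX_sub : ∀ ξ, X ξ ⊆ 𝒳) (hX_convex : ∀ ξ, Convex ℝ (X ξ))
    (hX_meas : MeasurableSet {p : EuclideanSpace ℝ (Fin d) × 𝒴 | p.1 ∈ X p.2})
    (h_unique : ∀ m : ℕ, 1 ≤ m → ∀ s : Fin m → 𝒴, ∃! x, IsScenarioSolution c 𝒳 X s x)
    (hxhat : ∀ m : ℕ, 1 ≤ m → ∀ s : Fin m → 𝒴, IsScenarioSolution c 𝒳 X s (xhat m s))
    (hxhat_meas : ∀ m : ℕ, Measurable (xhat m)) {δ : (Fin n → 𝒴) → ℝ} (hδ_meas : Measurable δ)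
    (hδ : ∀ D, 0 < δ D) {β : ℝ} (hβ : 0 < β) (hβ1 : β < 1) :
    jointLaw P n P₀ (goodEvent X xhat P₀ δ β)ᶜ ≤ ENNReal.ofReal β := by
  have hG := measurableSet_goodEvent P₀ hX_meas hxhat_meas hδ_meas hδ hβ
  rw [jointLaw, Measure.compProd_apply hG.compl]
  calc _ ≤ ∫⁻ _, ENNReal.ofReal β ∂Measure.pi fun _ : Fin n => (P : Measure 𝒴) := by
        refine lintegral_mono fun D => ?_
        have hpair : MeasurableSet {p : (Fin (Nexact (δ D) β d) → 𝒴) × 𝒴 | xhat _ p.1 ∉ X p.2} :=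
          (((hxhat_meas _).comp measurable_fst).prodMk measurable_snd hX_meas).compl
        have hbad : MeasurableSet {s : Fin (Nexact (δ D) β d) → 𝒴 |
            ENNReal.ofReal (δ D) < P₀ D {ξ | xhat _ s ∉ X ξ}} :=
          measurableSet_lt measurable_const (measurable_measure_prodMk_left hpair)
        have hpre : Prod.mk D ⁻¹' (goodEvent X xhat P₀ δ β)ᶜ
            = (fun (u : ℕ → 𝒴) (i : Fin (Nexact (δ D) β d)) => u i) ⁻¹'
              {s | ENNReal.ofReal (δ D) < P₀ D {ξ | xhat _ s ∉ X ξ}} := by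
          ext u
          exact not_le (α := ℝ≥0∞)
        rw [mcKernel_apply, hpre,
          (measurePreserving_restrict_fin (P₀ D) _).measure_preimage hbad.nullMeasurableSet]
        exact measure_violation_Nexact_le (P₀ D) hX_sub hX_convex hX_meas h_unique hxhat hxhat_meas
          (hδ D) hβ hβ1
    _ = _ := by rw [lintegral_const, measure_univ, mul_one]

end Problem

end ScenarioDRO

/-- `xhat m s` is the solution of the scenario program with the `m` samples `s`. The data are
`D = (ξ₁, …, ξₙ)`; the uncertainty set `U`, the generating distribution `P₀` and the level `δ` may
depend on the data. -/
theorem mainTheorem1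
    {𝒴 : Type*} [MeasurableSpace 𝒴] {d : ℕ}
    (c : EuclideanSpace ℝ (Fin d)) (𝒳 : Set (EuclideanSpace ℝ (Fin d)))
    (X : 𝒴 → Set (EuclideanSpace ℝ (Fin d)))
    (hX_sub : ∀ ξ, X ξ ⊆ 𝒳)
    (hX_convex : ∀ ξ, Convex ℝ (X ξ))
    (hX_meas : MeasurableSet {p : EuclideanSpace ℝ (Fin d) × 𝒴 | p.1 ∈ X p.2})
    -- every instance of the scenario program has a feasible region with nonempty interior
    -- and a unique optimal solution
    (h_interior : ∀ m : ℕ, 1 ≤ m → ∀ s : Fin m → 𝒴,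
      (interior (ScenarioDRO.scenarioRegion 𝒳 X s)).Nonempty)
    (h_unique : ∀ m : ℕ, 1 ≤ m → ∀ s : Fin m → 𝒴,
      ∃! x, ScenarioDRO.IsScenarioSolution c 𝒳 X s x)
    (xhat : (m : ℕ) → (Fin m → 𝒴) → EuclideanSpace ℝ (Fin d))
    (hxhat : ∀ m : ℕ, 1 ≤ m → ∀ s : Fin m → 𝒴,
      ScenarioDRO.IsScenarioSolution c 𝒳 X s (xhat m s))
    (hxhat_meas : ∀ m : ℕ, Measurable (xhat m))
    (P : ProbabilityMeasure 𝒴) (n : ℕ)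
    (U : (Fin n → 𝒴) → Set (ProbabilityMeasure 𝒴))
    (P₀ : Kernel (Fin n → 𝒴) 𝒴) [IsMarkovKernel P₀]
    (ε β : ℝ) (hε : 0 < ε) (hβ : 0 < β)
    (δ : (Fin n → 𝒴) → ℝ) (hδ_meas : Measurable δ) (hδ : ∀ D, 0 < δ D)
    (hM : ∀ D, ScenarioDRO.boundM (P₀ D) (U D) (δ D) ≤ ENNReal.ofReal ε) :
    -- robust feasibility, conditionally on the data
    (∀ D : Fin n → 𝒴,
      ScenarioDRO.HoldsWithConfidence
        (Measure.pi fun _ : Fin (ScenarioDRO.Nexact (δ D) β d) => P₀ D) (1 - β)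
        (fun s => ScenarioDRO.DRCCPFeasible 𝒳 X ε (U D)
          (xhat (ScenarioDRO.Nexact (δ D) β d) s))) ∧
    -- robust feasibility, jointly over the data and the Monte Carlo samples
    ScenarioDRO.HoldsWithConfidence (ScenarioDRO.jointLaw P n P₀) (1 - β)
      (fun ω => ScenarioDRO.DRCCPFeasible 𝒳 X ε (U ω.1)
        (xhat (ScenarioDRO.Nexact (δ ω.1) β d) (fun i => ω.2 i))) ∧
    -- feasibility for the original chance-constrained program
    (∀ α : ℝ,
      ScenarioDRO.HoldsWithConfidence (Measure.pi fun _ : Fin n => (P : Measure 𝒴)) (1 - α)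
        (fun D => P ∈ U D) →
      ScenarioDRO.HoldsWithConfidence (ScenarioDRO.jointLaw P n P₀) (1 - α - β)
        (fun ω => ScenarioDRO.CCPFeasible 𝒳 X ε P
          (xhat (ScenarioDRO.Nexact (δ ω.1) β d) (fun i => ω.2 i)))) := by
  have hX_point : ∀ x, MeasurableSet {ξ | x ∈ X ξ} := fun x => measurable_prodMk_left hX_meas
  have : Nonempty 𝒴 := (P : Measure 𝒴).nonempty_of_neZero
  rcases le_or_gt 1 β with hβ1 | hβ1
  · -- a confidence of at most `0` is witnessed by the empty event
    have hzero : ∀ {Ω : Type _} [MeasurableSpace Ω] (μ : Measure Ω) {γ : ℝ} (G : Ω → Prop),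
        γ ≤ 0 → ScenarioDRO.HoldsWithConfidence μ γ G := fun μ γ G h =>
      ⟨∅, .empty, by rw [ENNReal.ofReal_of_nonpos h]; exact zero_le, fun _ h => h.elim⟩
    refine ⟨fun D => hzero _ _ (by linarith), hzero _ _ (by linarith), fun α hα => ?_⟩
    obtain ⟨A, -, hA, -⟩ := hα
    have h1 : ENNReal.ofReal (1 - α) ≤ 1 := hA.trans prob_le_one
    rw [ENNReal.ofReal_le_one] at h1
    exact hzero _ _ (by linarith)
  have hG := ScenarioDRO.measurableSet_goodEvent P₀ hX_meas hxhat_meas hδ_meas hδ hβ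
  have hGβ := ScenarioDRO.jointLaw_compl_goodEvent_le P P₀ hX_sub hX_convex hX_meas h_unique hxhat
    hxhat_meas hδ_meas hδ hβ hβ1
  have hmem := fun D => ScenarioDRO.xhat_Nexact_mem hxhat (hδ D) hβ hβ1
  refine ⟨fun D => ?_, ?_, fun α hα => ?_⟩
  · have hpair : MeasurableSet {p : (Fin (ScenarioDRO.Nexact (δ D) β d) → 𝒴) × 𝒴 |
        xhat _ p.1 ∉ X p.2} :=
      (((hxhat_meas _).comp measurable_fst).prodMk measurable_snd hX_meas).compl
    have hgood : MeasurableSet {s : Fin (ScenarioDRO.Nexact (δ D) β d) → 𝒴 |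
        P₀ D {ξ | xhat _ s ∉ X ξ} ≤ ENNReal.ofReal (δ D)} :=
      measurableSet_le (measurable_measure_prodMk_left hpair) measurable_const
    refine ⟨_, hgood, ScenarioDRO.ofReal_one_sub_le_measure hgood hβ.le ?_, fun s hs =>
      ⟨hmem D s, le_iInf₂ fun Q hQ =>
        ScenarioDRO.ofReal_one_sub_le_of_boundM_le (hX_point _) hε.le (hM D) hs hQ⟩⟩
    simp only [Set.compl_ofPred, not_le]
    exact ScenarioDRO.measure_violation_Nexact_le (P₀ D) hX_sub hX_convex hX_meas h_unique hxhat
      hxhat_meas (hδ D) hβ hβ1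
  · exact ⟨_, hG, ScenarioDRO.ofReal_one_sub_le_measure hG hβ.le hGβ, fun ω hω =>
      ⟨hmem _ _, le_iInf₂ fun Q hQ =>
        ScenarioDRO.ofReal_one_sub_le_of_boundM_le (hX_point _) hε.le (hM ω.1) hω hQ⟩⟩
  · obtain ⟨A, hA, hAα, hAU⟩ := hα
    refine ⟨Prod.fst ⁻¹' A ∩ ScenarioDRO.goodEvent X xhat P₀ δ β, (measurable_fst hA).inter hG, ?_,
      fun ω hω => ⟨hmem _ _, ScenarioDRO.ofReal_one_sub_le_of_boundM_le (hX_point _) hε.le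
        (hM ω.1) hω.2 (hAU _ hω.1)⟩⟩
    have hfst : ScenarioDRO.jointLaw P n P₀ (Prod.fst ⁻¹' A)
        = Measure.pi (fun _ : Fin n => (P : Measure 𝒴)) A := by
      rw [← Measure.fst_apply hA, ScenarioDRO.jointLaw, Measure.fst_compProd]
    rw [ENNReal.ofReal_sub _ hβ.le, tsub_le_iff_right]
    calc ENNReal.ofReal (1 - α) ≤ ScenarioDRO.jointLaw P n P₀ (Prod.fst ⁻¹' A) := hfst ▸ hAα
      _ ≤ ScenarioDRO.jointLaw P n P₀ (Prod.fst ⁻¹' A ∩ ScenarioDRO.goodEvent X xhat P₀ δ β)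
          + ScenarioDRO.jointLaw P n P₀ (Prod.fst ⁻¹' A \ ScenarioDRO.goodEvent X xhat P₀ δ β) :=
          (measure_inter_add_sdiff _ hG).ge
      _ ≤ _ := by
          gcongr
          exact (measure_mono fun ω hω => hω.2).trans hGβ
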